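/- Let $n\ge 1$, let $\mathcal S_{\mathbb C}(n)$ be the Schwartz space of smooth rapidly decreasing functions $f:\mathbb R^n\to\mathbb C$, let $f*g$ be the convolution $(f*g)(x)=\int_{\mathbb R^n}f(t)\,g(x-t)\,dt$, let $f\cdot g$ be the pointwise product, and let $(\mathcal F f)(t)=\int_{\mathbb R^n}f(x)\,e^{-2\pi i\langle x,t\rangle}\,dx$ be the Fourier transform. Let $T:\mathcal S_{\mathbb C}(n)\to\mathcal S_{\mathbb C}(n)$ be a bijection (not assumed linear or continuous). 1. Assume that $T(f*g)=Tf\cdot Tg$ for all $f,g\in\mathcal S_{\mathbb C}(n)$. Then there exists a $C^\infty$-diffeomorphism $u:\mathbb R^n\to\mathbb R^n$ such that either $(Tf)(u(x))=(\mathcal F f)(x)$ for all $f\in\mathcal S_{\mathbb C}(n)$ and $x\in\mathbb R^n$, or $(Tf)(u(x))=(\mathcal F\overline{f})(x)$ for all $f\in\mathcal S_{\mathbb C}(n)$ and $x\in\mathbb R^n$. 2. Assume that $T(f\cdot g)=Tf*Tg$ for all $f,g\in\mathcal S_{\mathbb C}(n)$. Then there exists a $C^\infty$-diffeomorphism $u:\mathbb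 R^n\to\mathbb R^n$ such that $f\circ u\in\mathcal S_{\mathbb C}(n)$ for every $f\in\mathcal S_{\mathbb C}(n)$, and either $Tf=\mathcal F(f\circ u)$ for all $f\in\mathcal S_{\mathbb C}(n)$, or $Tf=\mathcal F(\overline{f\circ u})$ for all $f\in\mathcal S_{\mathbb C}(n)$. -/

import Mathlib

open MeasureTheory
open scoped SchwartzMap FourierTransform ContDiff Manifold ComplexConjugate

noncomputable section

namespace SchwartzFourier

/-- The Schwartz space of complex-valued rapidly decreasing functions on `ℝⁿ`
(with its Euclidean norm). -/
abbrev Schw (n : ℕ) : Type :=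
  SchwartzMap (EuclideanSpace ℝ (Fin n)) ℂ

/-- Smooth diffeomorphisms of `ℝⁿ` onto itself. -/
abbrev Diffeo (n : ℕ) : Type :=
  Diffeomorph 𝓘(ℝ, EuclideanSpace ℝ (Fin n)) 𝓘(ℝ, EuclideanSpace ℝ (Fin n))
    (EuclideanSpace ℝ (Fin n)) (EuclideanSpace ℝ (Fin n)) ∞

/-- The convolution integral of two Schwartz functions agrees with Mathlib's bundled one. -/
theorem integral_eq_convolution {n : ℕ} (f g : Schw n) :
    (fun x => ∫ t, f t * g (x - t)) =
      ⇑(SchwartzMap.convolution (ContinuousLinearMap.mul ℂ ℂ) f g) := by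
  funext x
  rw [SchwartzMap.convolution_apply]
  rfl

/-- The convolution `(f * g)(x) = ∫ f(t) g(x - t) dt` of two Schwartz functions. -/
def conv {n : ℕ} (f g : Schw n) : Schw n where
  toFun x := ∫ t, f t * g (x - t)
  smooth' := by
    rw [integral_eq_convolution]
    exact SchwartzMap.smooth' _
  decay' := by
    rw [integral_eq_convolution]
    exact SchwartzMap.decay' _

/-- The pointwise product of two Schwartz functions. -/
def prod {n : ℕ} (f g : Schw n) : Schw n where
  toFun x := f x * g x
  smooth' := (SchwartzMap.pairing (ContinuousLinearMap.mul ℂ ℂ) f g).smooth'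
  decay' := (SchwartzMap.pairing (ContinuousLinearMap.mul ℂ ℂ) f g).decay'

/-- The pointwise complex conjugate of a Schwartz function. -/
def conjS {n : ℕ} (f : Schw n) : Schw n where
  toFun x := conj (f x)
  smooth' := (SchwartzMap.postcompCLM (𝕜 := ℝ) (Complex.conjCLE : ℂ →L[ℝ] ℂ) f).smooth'
  decay' := (SchwartzMap.postcompCLM (𝕜 := ℝ) (Complex.conjCLE : ℂ →L[ℝ] ℂ) f).decay'

/-- On Schwartz functions `𝓕` is the usual Fourier integral. -/
theorem fourier_apply {n : ℕ} (f : Schw n) (t : EuclideanSpace ℝ (Fin n)) :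
    (𝓕 f : Schw n) t =
      ∫ x, f x * Complex.exp (-2 * Real.pi * Complex.I * (inner ℝ x t : ℝ)) := by
  rw [SchwartzMap.fourier_coe, Real.fourier_eq']
  refine integral_congr_ae (Filter.Eventually.of_forall fun x => ?_)
  simp only [smul_eq_mul]
  rw [mul_comm]
  congr 2
  push_cast
  ring

end SchwartzFourier

end

/-! The Fourier transform turns convolution into multiplication, so both claims reduce to one: a
bijection `T` of the Schwartz space with `T (f g) = T f · T g` is, up to a diffeomorphism `u`, the
identity or complex conjugation (`MulPres.exists_diffeo`).

Multiplication sees supports: `f h = h` says that `f = 1` on the support of `h`. This yields a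
homeomorphism `u` such that the germ of `T f` at `u x` depends only on the germ of `f` at `x`, so
that `T` induces multiplicative maps on germs. Neither continuity nor additivity is given. The
substitute is a gliding hump argument (`exists_ball_bound`): a local quantity that is locally
bounded for each function is bounded on some small ball by finitely many derivatives, uniformly in
the function. Such balls exist inside every nonempty open set, and continuity carries the
conclusions to all points.

Absolute values: comparing high powers of a germ with powers of `1/2` gives `|T f (u x)| = |f x| ^ p
x`. Testing on exponentials of linear forms makes `u` and its inverse smooth. Differentiability at a
simple zero gives `p ≥ 1`, the same holds for the inverse map, and the two exponents multiply to
one; hence `p = 1`.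

Phases: the logarithmic derivative of `T f ∘ u` is additive on nonvanishing germs and has finite
order. It kills perturbations `1 + k h ^ m` of high order, then by factorization all those of order
two, so it depends on the first jet only (`LdBound.eq_taylor`). A germ of value one can therefore be
changed to `1` within distance `O(1/m)` at bounded derivative cost, and its image has value one.
Thus `T f (u x)` depends only on the number `f x`. A second difference of images of affine functions
at scale `2⁻ⁱ` shows that this dependence on the number is additive (`ev_const_jensen`); being
multiplicative and norm preserving as well, it is the identity or the conjugation. Connectedness
makes the choice the same at all points. -/

namespace SchwartzMul

/-! ### Supports, germs and the induced homeomorphism -/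

open Filter Topology

variable {E : Type} [NormedAddCommGroup E] [InnerProductSpace ℝ E]

/-- The pointwise product of Schwartz functions. -/
noncomputable def sm (f g : 𝓢(E, ℂ)) : 𝓢(E, ℂ) :=
  SchwartzMap.pairing (ContinuousLinearMap.mul ℂ ℂ) f g

@[simp] theorem sm_apply (f g : 𝓢(E, ℂ)) (x : E) : sm f g x = f x * g x := rfl

/-- A bijection of the Schwartz space that preserves pointwise products. -/
def MulPres (T : 𝓢(E, ℂ) ≃ 𝓢(E, ℂ)) : Prop := ∀ f g, T (sm f g) = sm (T f) (T g)

variable {T : 𝓢(E, ℂ) ≃ 𝓢(E, ℂ)}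

theorem MulPres.symm (hT : MulPres T) : MulPres T.symm := fun f g => by
  apply T.injective
  rw [hT]; simp

theorem MulPres.map_zero (hT : MulPres T) : T 0 = 0 := by
  have h := hT 0 (T.symm 0)
  have h0 : sm (0 : 𝓢(E, ℂ)) (T.symm 0) = 0 := by ext x; simp
  rw [h0] at h
  rw [h]; ext x; simp

theorem contDiff_coe (f : 𝓢(E, ℂ)) : ContDiff ℝ ∞ f := f.smooth _

/-- `F` is smooth in a neighbourhood of `x`. -/
def IsSm (F : E → ℂ) (x : E) : Prop := ∀ᶠ y in 𝓝 x, ContDiffAt ℝ ∞ F y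

theorem _root_.ContDiff.isSm {F : E → ℂ} (h : ContDiff ℝ ∞ F) (x : E) : IsSm F x :=
  Eventually.of_forall fun _ => h.contDiffAt

section Cutoff

variable [FiniteDimensional ℝ E]

theorem exists_ball_cutoff (x : E) {r R : ℝ} (hr : 0 < r) (hR : r < R) :
    ∃ χ : 𝓢(E, ℂ), HasCompactSupport χ ∧ tsupport χ ⊆ Metric.closedBall x R ∧
      ∀ y ∈ Metric.closedBall x r, χ y = 1 := by
  let b : ContDiffBump x := ⟨r, R, hr, hR⟩
  have hc : HasCompactSupport fun y => (b y : ℂ) :=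
    b.hasCompactSupport.comp_left (g := Complex.ofReal) rfl
  have hs : ContDiff ℝ ∞ fun y => (b y : ℂ) := Complex.ofRealCLM.contDiff.comp b.contDiff
  refine ⟨hc.toSchwartzMap hs, hc, ?_, fun y hy => ?_⟩
  · rw [← b.tsupport_eq]
    refine closure_mono fun y hy => ?_
    intro h
    apply hy
    change ((b y : ℝ) : ℂ) = 0
    rw [h]; simp
  · change ((b y : ℝ) : ℂ) = 1
    rw [b.one_of_mem_closedBall hy]; simp

theorem exists_cutoff {x : E} {U : Set E} (hU : U ∈ 𝓝 x) :
    ∃ χ : 𝓢(E, ℂ), HasCompactSupport χ ∧ tsupport χ ⊆ U ∧ ∀ᶠ y in 𝓝 x, χ y = 1 := by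
  obtain ⟨R, hR, hRU⟩ := Metric.nhds_basis_closedBall.mem_iff.1 hU
  obtain ⟨χ, h1, h2, h3⟩ := exists_ball_cutoff x (half_pos hR) (half_lt_self hR)
  exact ⟨χ, h1, h2.trans hRU,
    mem_of_superset (Metric.closedBall_mem_nhds x (half_pos hR)) h3⟩

/-- Smoothness on a whole neighbourhood is essential: `ContDiffAt ℝ ∞` at the single point `x` only
gives `C^n` on neighbourhoods that may shrink with `n`, and no cutoff could then be chosen. -/
theorem IsSm.exists_eq {F : E → ℂ} {x : E} (h : IsSm F x) :
    ∃ g : 𝓢(E, ℂ), HasCompactSupport g ∧ ∀ᶠ y in 𝓝 x, g y = F y := by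
  obtain ⟨χ, h1, h2, h3⟩ := exists_cutoff h
  have hc : HasCompactSupport fun y => χ y * F y := h1.mul_right
  have hs : ContDiff ℝ ∞ fun y => χ y * F y := by
    rw [contDiff_iff_contDiffAt]
    intro y
    by_cases hy : y ∈ tsupport χ
    · exact (contDiff_coe χ).contDiffAt.mul (h2 hy)
    · have : (fun y => χ y * F y) =ᶠ[𝓝 y] fun _ => 0 := by
        filter_upwards [(isClosed_tsupport χ).isOpen_compl.mem_nhds hy] with z hz
        rw [image_eq_zero_of_notMem_tsupport hz, zero_mul]
      exact contDiffAt_const.congr_of_eventuallyEq this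
  refine ⟨hc.toSchwartzMap hs, hc, ?_⟩
  filter_upwards [h3] with y hy
  change χ y * F y = F y
  rw [hy, one_mul]

end Cutoff

/-- `y` corresponds to `x` if it is in the support of `T f` whenever `f = 1` near `x`. -/
def Corr (T : 𝓢(E, ℂ) ≃ 𝓢(E, ℂ)) (x y : E) : Prop :=
  ∀ f : 𝓢(E, ℂ), (∀ᶠ z in 𝓝 x, f z = 1) → y ∈ tsupport (T f)

theorem sm_eq_of_eventually {f h : 𝓢(E, ℂ)} (H : tsupport h ⊆ {z | f z = 1}) : sm f h = h := by
  ext z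
  by_cases hz : z ∈ tsupport h
  · simp [show f z = 1 from H hz]
  · simp [image_eq_zero_of_notMem_tsupport hz]

theorem eq_one_of_mem_tsupport {f h : 𝓢(E, ℂ)} (H : sm f h = h) {z : E} (hz : z ∈ tsupport h) :
    f z = 1 := by
  have hcl : IsClosed {z | f z = 1} := isClosed_eq f.continuous continuous_const
  refine closure_minimal (fun w hw => ?_) hcl hz
  have h1 : f w * h w = h w := by rw [← sm_apply, H]
  exact mul_right_cancel₀ (b := h w) hw (by simpa using h1)

theorem eventually_eq_zero_of_sm {f g : 𝓢(E, ℂ)} {x : E} (H : sm f g = 0) (h : f x ≠ 0) :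
    ∀ᶠ z in 𝓝 x, g z = 0 := by
  filter_upwards [f.continuous.continuousAt.eventually_ne h] with z hz
  have h1 : f z * g z = 0 := by rw [← sm_apply, H]; rfl
  exact (mul_eq_zero.1 h1).resolve_left hz

theorem notMem_tsupport_of_eventually {g : 𝓢(E, ℂ)} {x : E} (h : ∀ᶠ z in 𝓝 x, g z = 0) :
    x ∉ tsupport g := notMem_tsupport_iff_eventuallyEq.2 h

section Corr

variable [FiniteDimensional ℝ E]

theorem exists_cutoff_sm {f : 𝓢(E, ℂ)} {x : E} (hf : ∀ᶠ z in 𝓝 x, f z = 1) :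
    ∃ h : 𝓢(E, ℂ), (∀ᶠ z in 𝓝 x, h z = 1) ∧ sm f h = h := by
  obtain ⟨χ, h1, h2, h3⟩ := exists_cutoff hf
  exact ⟨χ, h3, sm_eq_of_eventually h2⟩

/-- The function `h` equals one on the support of `f` but tends to zero at infinity. Compactness of
a support thus follows from a purely multiplicative relation, which `T` preserves. -/
theorem hasCompactSupport_of_sm {f h : 𝓢(E, ℂ)} (H : sm h f = f) : HasCompactSupport f := by
  have h1 := h.tendsto_cocompact
  have h2 : ∀ᶠ z in cocompact E, h z ≠ 1 := h1.eventually_ne zero_ne_one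
  obtain ⟨K, hK, hK'⟩ := mem_cocompact.1 h2
  refine hK.of_isClosed_subset (isClosed_tsupport f) fun z hz => ?_
  by_contra hzK
  exact hK' hzK (eq_one_of_mem_tsupport H hz)

theorem MulPres.exists_corr (hT : MulPres T) (x : E) : ∃ y, Corr T x y := by
  obtain ⟨χ, -, -, hχ⟩ := exists_cutoff (univ_mem : Set.univ ∈ 𝓝 x)
  obtain ⟨f₀, hf₀, hχf⟩ := exists_cutoff_sm hχ
  have hc : HasCompactSupport (T f₀) :=
    hasCompactSupport_of_sm (h := T χ) (by rw [← hT, hχf])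
  let ι := {f : 𝓢(E, ℂ) // ∀ᶠ z in 𝓝 x, f z = 1}
  let t : ι → Set E := fun f => tsupport (T (sm f.1 f₀))
  have hsub : ∀ f g : 𝓢(E, ℂ), tsupport (T (sm f g)) ⊆ tsupport (T f) := fun f g => by
    rw [hT]
    exact closure_mono fun z hz h => hz (by simp [h])
  have hsub' : ∀ f g : 𝓢(E, ℂ), tsupport (T (sm f g)) ⊆ tsupport (T g) := fun f g => by
    rw [hT]
    exact closure_mono fun z hz h => hz (by simp [h])
  have : Nonempty ι := ⟨⟨χ, hχ⟩⟩
  -- The supports are directed because the support of `T (f g)` lies in those of `T f` and `T g`.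
  -- They are nonempty because `T` is injective with `T 0 = 0`, and compact because they lie in the
  -- support of `T f₀`.
  have hne : (⋂ i, t i).Nonempty := by
    refine IsCompact.nonempty_iInter_of_directed_nonempty_isCompact_isClosed t ?_ ?_ ?_ ?_
    · intro f g
      refine ⟨⟨sm f.1 g.1, ?_⟩, ?_, ?_⟩
      · filter_upwards [f.2, g.2] with z h1 h2
        simp [h1, h2]
      · have : sm (sm f.1 g.1) f₀ = sm (sm f.1 f₀) g.1 := by ext z; simp; ring
        simp only [t, this]
        exact hsub _ _
      · have : sm (sm f.1 g.1) f₀ = sm f.1 (sm g.1 f₀) := by ext z; simp; ring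
        simp only [t, this]
        exact hsub' _ _
    · intro f
      by_contra hem
      rw [Set.not_nonempty_iff_eq_empty, tsupport_eq_empty_iff] at hem
      have h0 : T (sm f.1 f₀) = T 0 := by
        rw [hT.map_zero]; ext z; exact congrFun hem z
      have h1 := T.injective h0
      have h2 : f.1 x * f₀ x = 0 := by rw [← sm_apply, h1]; rfl
      rw [f.2.self_of_nhds, hf₀.self_of_nhds] at h2
      simp at h2
    · intro f
      exact hc.of_isClosed_subset (isClosed_tsupport _) (hsub' _ _)
    · intro f
      exact isClosed_tsupport _
  obtain ⟨y, hy⟩ := hne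
  refine ⟨y, fun f hf => ?_⟩
  exact hsub _ _ (Set.mem_iInter.1 hy ⟨f, hf⟩)

/-- Otherwise some `f` equal to one near `x` annihilates `T.symm g`. Then `T f · g = 0` with `g = 1`
near `y`, so `T f` vanishes near `y`. -/
theorem Corr.symm {x y : E} (h : Corr T x y) (hT : MulPres T) : Corr T.symm y x := by
  intro g hg
  by_contra hx
  obtain ⟨f, -, hf, hf1⟩ := exists_cutoff ((isClosed_tsupport _).isOpen_compl.mem_nhds hx)
  have h0 : sm f (T.symm g) = 0 := by
    ext z
    by_cases hz : z ∈ tsupport f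
    · simp [image_eq_zero_of_notMem_tsupport (hf hz)]
    · simp [image_eq_zero_of_notMem_tsupport hz]
  have h1 : sm (T f) g = 0 := by
    have := hT f (T.symm g)
    rw [h0, hT.map_zero] at this
    simpa using this.symm
  refine notMem_tsupport_of_eventually ?_ (h f hf1)
  filter_upwards [hg] with z hz
  have h2 : T f z * g z = 0 := by rw [← sm_apply, h1]; rfl
  simpa [hz] using h2

theorem Corr.unique {x y₁ y₂ : E} (h₁ : Corr T x y₁) (h₂ : Corr T x y₂) (hT : MulPres T) :
    y₁ = y₂ := by
  by_contra hne
  obtain ⟨U₁, U₂, hU₁, hU₂, hd⟩ := t2_separation_nhds hne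
  obtain ⟨a, -, ha, ha1⟩ := exists_cutoff hU₁
  obtain ⟨b, -, hb, hb1⟩ := exists_cutoff hU₂
  obtain ⟨c, hc1, hc⟩ := exists_cutoff_sm ha1
  have hx₁ := h₁.symm hT c hc1
  have hx₂ := h₂.symm hT b hb1
  have hac : sm (T.symm a) (T.symm c) = T.symm c := by rw [← hT.symm, hc]
  have hab : sm (T.symm a) (T.symm b) = 0 := by
    rw [← hT.symm, ← hT.symm.map_zero]
    congr 1
    ext z
    by_cases hz : z ∈ tsupport a
    · have : z ∉ tsupport b := fun h => Set.disjoint_left.1 hd (ha hz) (hb h)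
      simp [image_eq_zero_of_notMem_tsupport this]
    · simp [image_eq_zero_of_notMem_tsupport hz]
  have h3 := eq_one_of_mem_tsupport hac hx₁
  exact notMem_tsupport_of_eventually (eventually_eq_zero_of_sm hab (by rw [h3]; simp)) hx₂

/-- Two nested cutoffs are used: `a b = b` forces `T a = 1` at `y`, and `f a = a` then forces `T f =
1` wherever `T a` is nonzero. -/
theorem Corr.eventually_one {x y : E} (h : Corr T x y) (hT : MulPres T) {f : 𝓢(E, ℂ)}
    (hf : ∀ᶠ z in 𝓝 x, f z = 1) : ∀ᶠ z in 𝓝 y, T f z = 1 := by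
  obtain ⟨a, ha, hfa⟩ := exists_cutoff_sm hf
  obtain ⟨b, hb, hab⟩ := exists_cutoff_sm ha
  have h1 : T a y = 1 := eq_one_of_mem_tsupport (by rw [← hT, hab]) (h b hb)
  have h2 : sm (T f) (T a) = T a := by rw [← hT, hfa]
  filter_upwards [(T a).continuous.continuousAt.eventually_ne (h1 ▸ one_ne_zero)] with z hz
  have h3 : T f z * T a z = T a z := by rw [← sm_apply, h2]
  exact mul_right_cancel₀ hz (by simpa using h3)

/-- This locality is what makes the action of `T` on germs well defined. -/
theorem Corr.eventually_eq {x y : E} (h : Corr T x y) (hT : MulPres T) {f g : 𝓢(E, ℂ)}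
    (hf : ∀ᶠ z in 𝓝 x, f z = g z) : ∀ᶠ z in 𝓝 y, T f z = T g z := by
  obtain ⟨χ, -, h2, h3⟩ := exists_cutoff hf
  have h4 : sm χ f = sm χ g := by
    ext z
    by_cases hz : z ∈ tsupport χ
    · simp [show f z = g z from h2 hz]
    · simp [image_eq_zero_of_notMem_tsupport hz]
  have h5 : sm (T χ) (T f) = sm (T χ) (T g) := by rw [← hT, ← hT, h4]
  filter_upwards [h.eventually_one hT h3] with z hz
  have h6 : T χ z * T f z = T χ z * T g z := by rw [← sm_apply, h5, sm_apply]
  simpa [hz] using h6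

theorem Corr.continuousAt {u : E → E} (hu : ∀ x, Corr T x (u x)) (hT : MulPres T) :
    Continuous u := by
  rw [continuous_iff_continuousAt]
  intro x V hV
  -- The preimage of `g` is one near `x`, hence near every `z` close to `x`; so `g = 1` at `u z`,
  -- which puts `u z` in `V`.
  obtain ⟨g, -, h2, h3⟩ := exists_cutoff hV
  have h4 := ((hu x).symm hT).eventually_one hT.symm h3
  rw [mem_map]
  filter_upwards [h4.eventually_nhds] with z hz
  have h5 := (hu z).eventually_one hT hz
  rw [Equiv.apply_symm_apply] at h5
  apply h2
  apply subset_tsupport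
  rw [Function.mem_support, h5.self_of_nhds]
  exact one_ne_zero

theorem MulPres.exists_homeomorph (hT : MulPres T) :
    ∃ u : E ≃ₜ E, (∀ x, Corr T x (u x)) ∧ ∀ y, Corr T.symm y (u.symm y) := by
  choose u hu using hT.exists_corr
  choose v hv using hT.symm.exists_corr
  refine ⟨⟨⟨u, v, fun x => ?_, fun y => ?_⟩, Corr.continuousAt hu hT, Corr.continuousAt hv hT.symm⟩,
    hu, hv⟩
  · exact (hv (u x)).unique ((hu x).symm hT) hT.symm
  · exact (hu (v y)).unique ((hv y).symm hT.symm) hT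

end Corr

end SchwartzMul

/-! ### `C^N` bounds and the gliding hump -/

namespace SchwartzMul

open Filter Topology

/-- All derivatives of `F` up to order `N` are bounded by `C`. -/
def CB {V : Type} [NormedAddCommGroup V] [NormedSpace ℝ V] (N : ℕ) (C : ℝ) (F : V → ℂ) : Prop :=
  ∀ l ≤ N, ∀ y, ‖iteratedFDeriv ℝ l F y‖ ≤ C

section

variable {V : Type} [NormedAddCommGroup V] [NormedSpace ℝ V]

theorem CB.nonneg {N : ℕ} {C : ℝ} {F : V → ℂ} (h : CB N C F) : 0 ≤ C :=
  (norm_nonneg _).trans (h 0 (Nat.zero_le _) 0)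

theorem CB.norm_le {N : ℕ} {C : ℝ} {F : V → ℂ} (h : CB N C F) (y : V) : ‖F y‖ ≤ C := by
  simpa using h 0 (Nat.zero_le _) y

theorem CB.mono {N : ℕ} {C D : ℝ} {F : V → ℂ} (h : CB N C F) (hD : C ≤ D) : CB N D F :=
  fun l hl y => (h l hl y).trans hD

theorem CB.mul {N : ℕ} {C D : ℝ} {F G : V → ℂ} (hF : ContDiff ℝ ∞ F) (hG : ContDiff ℝ ∞ G)
    (h : CB N C F) (h' : CB N D G) : CB N (2 ^ N * C * D) (fun y => F y * G y) := by
  intro l hl y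
  have hle : (l : WithTop ℕ∞) ≤ ∞ := by exact_mod_cast le_top
  refine (norm_iteratedFDeriv_mul_le hF hG y hle).trans ?_
  have hC := h.nonneg
  have hD := h'.nonneg
  calc ∑ i ∈ Finset.range (l + 1), (l.choose i : ℝ) * ‖iteratedFDeriv ℝ i F y‖ *
        ‖iteratedFDeriv ℝ (l - i) G y‖
      ≤ ∑ i ∈ Finset.range (l + 1), (l.choose i : ℝ) * (C * D) := by
        refine Finset.sum_le_sum fun i hi => ?_
        rw [mul_assoc]
        refine mul_le_mul_of_nonneg_left ?_ (Nat.cast_nonneg _)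
        have hi' : i ≤ l := Nat.lt_succ_iff.1 (Finset.mem_range.1 hi)
        exact mul_le_mul (h i (hi'.trans hl) y) (h' _ ((Nat.sub_le _ _).trans hl) y)
          (norm_nonneg _) hC
    _ = 2 ^ l * (C * D) := by
        rw [← Finset.sum_mul]
        congr 1
        exact_mod_cast Nat.sum_range_choose l
    _ ≤ 2 ^ N * (C * D) := by
        refine mul_le_mul_of_nonneg_right ?_ (mul_nonneg hC hD)
        exact pow_le_pow_right₀ (by norm_num) hl
    _ = 2 ^ N * C * D := by ring

theorem CB.add {N : ℕ} {C D : ℝ} {F G : V → ℂ} (hF : ContDiff ℝ ∞ F) (hG : ContDiff ℝ ∞ G)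
    (h : CB N C F) (h' : CB N D G) : CB N (C + D) (fun y => F y + G y) := by
  intro l hl y
  have hle : (l : WithTop ℕ∞) ≤ ∞ := by exact_mod_cast le_top
  have : iteratedFDeriv ℝ l (fun y => F y + G y) y =
      iteratedFDeriv ℝ l F y + iteratedFDeriv ℝ l G y :=
    iteratedFDeriv_add_apply (hF.of_le hle).contDiffAt (hG.of_le hle).contDiffAt
  rw [this]
  exact (norm_add_le _ _).trans (add_le_add (h l hl y) (h' l hl y))

theorem CB.const_mul {N : ℕ} {C : ℝ} {F : V → ℂ} (hF : ContDiff ℝ ∞ F) (h : CB N C F) (c : ℂ) :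
    CB N (‖c‖ * C) (fun y => c * F y) := by
  intro l hl y
  have hle : (l : WithTop ℕ∞) ≤ ∞ := by exact_mod_cast le_top
  have : iteratedFDeriv ℝ l (c • F) y = c • iteratedFDeriv ℝ l F y :=
    iteratedFDeriv_const_smul_apply (hF.of_le hle).contDiffAt
  change ‖iteratedFDeriv ℝ l (c • F) y‖ ≤ _
  rw [this, norm_smul]
  exact mul_le_mul_of_nonneg_left (h l hl y) (norm_nonneg _)

theorem CB.comp {N : ℕ} {C D : ℝ} {G : ℂ → ℂ} {F : V → ℂ} (hG : ContDiff ℝ ∞ G)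
    (hF : ContDiff ℝ ∞ F) (h : CB N C G) (h' : CB N D F) (hD : 1 ≤ D) :
    CB N (N.factorial * C * D ^ N) (fun y => G (F y)) := by
  intro l hl y
  have hle : (l : WithTop ℕ∞) ≤ ∞ := by exact_mod_cast le_top
  have hC := h.nonneg
  have h1 := norm_iteratedFDeriv_comp_le hG hF hle y (C := C) (D := D)
    (fun i hi => h i (hi.trans hl) _) fun i hi hi' =>
      (h' i (hi'.trans hl) y).trans (le_self_pow₀ hD (by lia))
  refine h1.trans ?_
  gcongr

theorem CB.comp_mul {N : ℕ} {C D : ℝ} {G : ℂ → ℂ} {F : V → ℂ} (hG : ContDiff ℝ ∞ G)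
    (hF : ContDiff ℝ ∞ F) (h : CB N C G) (h' : CB N D F) (hD : 1 ≤ D) {t : ℝ} (ht : 1 ≤ t) :
    CB N (N.factorial * C * D ^ N * t ^ N) (fun y => G (t * F y)) := by
  have h2 := CB.comp hG (contDiff_const.mul hF) h (h'.const_mul hF (t : ℂ)) (by
    rw [Complex.norm_real, Real.norm_of_nonneg (by linarith)]
    nlinarith)
  refine h2.mono (le_of_eq ?_)
  rw [Complex.norm_real, Real.norm_of_nonneg (by linarith)]
  ring

theorem CB.of_schwartz (N : ℕ) (g : 𝓢(V, ℂ)) : ∃ C : ℝ, 1 ≤ C ∧ CB N C g := by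
  refine ⟨1 + ∑ l ∈ Finset.range (N + 1), SchwartzMap.seminorm ℝ 0 l g, ?_, ?_⟩
  · have : 0 ≤ ∑ l ∈ Finset.range (N + 1), SchwartzMap.seminorm ℝ 0 l g :=
      Finset.sum_nonneg fun _ _ => apply_nonneg _ _
    linarith
  · intro l hl y
    have h1 := g.norm_iteratedFDeriv_le_seminorm ℝ l y
    have h2 := Finset.single_le_sum (f := fun l => SchwartzMap.seminorm ℝ 0 l g)
      (fun _ _ => apply_nonneg _ _) (Finset.mem_range.2 (Nat.lt_succ_iff.2 hl))
    exact h1.trans (h2.trans (le_add_of_nonneg_left zero_le_one))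

end

variable {E : Type} [NormedAddCommGroup E] [InnerProductSpace ℝ E] [FiniteDimensional ℝ E]

/-- A family of local quantities `Q x g` that is bounded on bounded sets for every `g` is
bounded, on some ball, uniformly over a neighbourhood of zero in some `C^N` norm. -/
theorem exists_ball_bound [Nontrivial E] (Q : E → 𝓢(E, ℂ) → ℝ)
    (hloc : ∀ x (f g : 𝓢(E, ℂ)), (∀ᶠ z in 𝓝 x, f z = g z) → Q x f = Q x g)
    (hb : ∀ g, ∀ x r, ∃ C, ∀ z ∈ Metric.closedBall x r, Q z g ≤ C)
    {W : Set E} (hW : IsOpen W) (hne : W.Nonempty) :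
    ∃ z r, 0 < r ∧ Metric.ball z r ⊆ W ∧ ∃ (N : ℕ) (δ C : ℝ), 0 < δ ∧
      ∀ x ∈ Metric.ball z r, ∀ g : 𝓢(E, ℂ), CB N δ g → Q x g ≤ C := by
  by_contra hcon
  push Not at hcon
  obtain ⟨x₀, hx₀⟩ := hne
  obtain ⟨R, hR, hRW⟩ := Metric.nhds_basis_closedBall.mem_iff.1 (hW.mem_nhds hx₀)
  obtain ⟨e, he⟩ := exists_norm_eq E zero_le_one
  -- Gliding hump: disjoint balls around points `c k` converge to `x₀` along a ray. In the `k`-th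
  -- ball the failure of the claim for order `k`, size `a k` and bound `k` gives a bad function;
  -- their cut-off sum is a single bad function.
  set s : ℕ → ℝ := fun k => R * (1 / 2) ^ k with hs
  have hs0 : ∀ k, 0 < s k := fun k => by positivity
  have hsR : ∀ k, s k ≤ R := fun k =>
    mul_le_of_le_one_right hR.le (pow_le_one₀ (by norm_num) (by norm_num))
  have hmono : ∀ k l, k < l → s l ≤ s k / 2 := fun k l hkl => by
    have : ((1 : ℝ) / 2) ^ l ≤ (1 / 2) ^ (k + 1) :=
      pow_le_pow_of_le_one (by norm_num) (by norm_num) hkl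
    calc s l ≤ R * (1 / 2) ^ (k + 1) := mul_le_mul_of_nonneg_left this hR.le
      _ = s k / 2 := by simp only [hs, pow_succ]; ring
  let c : ℕ → E := fun k => x₀ + (s k / 2) • e
  have hcd : ∀ k l, k < l → s k / 4 ≤ dist (c k) (c l) := fun k l hkl => by
    have h1 : c k - c l = (s k / 2 - s l / 2) • e := by simp only [c]; module
    rw [dist_eq_norm, h1, norm_smul, he, mul_one, Real.norm_eq_abs]
    refine le_trans ?_ (le_abs_self _)
    have := hmono k l hkl
    linarith
  choose χ hχc hχs hχ1 using fun k => exists_ball_cutoff (c k) (r := s k / 16) (R := s k / 10)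
    (by have := hs0 k; positivity) (by have := hs0 k; linarith)
  choose M hM1 hM using fun k => CB.of_schwartz k (χ k)
  -- The denominator is the loss from multiplying by `χ k` in `CB.mul`, so that the `k`-th hump has
  -- `C^k` norm at most `2⁻ᵏ`.
  let a : ℕ → ℝ := fun k => (1 / 2) ^ k / (2 ^ k * M k)
  have ha : ∀ k, 0 < a k := fun k => by have := hM1 k; positivity
  have hball : ∀ k, Metric.closedBall (c k) (s k / 10) ⊆ Metric.closedBall x₀ R := fun k => by
    apply Metric.closedBall_subset_closedBall'
    have : dist (c k) x₀ = s k / 2 := by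
      simp only [c, dist_eq_norm, add_sub_cancel_left, norm_smul, he, mul_one, Real.norm_eq_abs]
      exact abs_of_pos (half_pos (hs0 k))
    rw [this]
    have := hs0 k
    have := hsR k
    linarith
  have H : ∀ k : ℕ, ∃ x ∈ Metric.ball (c k) (s k / 16), ∃ g : 𝓢(E, ℂ), CB k (a k) g ∧
      (k : ℝ) < Q x g := fun k => by
    refine hcon (c k) (s k / 16) (by have := hs0 k; positivity) (fun y hy => hRW ?_) k (a k) k (ha k)
    apply hball k
    rw [Metric.mem_ball] at hy
    rw [Metric.mem_closedBall]
    have := hs0 k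
    linarith
  choose x hx g hg hQ using H
  let f : ℕ → E → ℂ := fun k y => χ k y * g k y
  have hfs : ∀ k, ContDiff ℝ ∞ (f k) := fun k => (contDiff_coe _).mul (contDiff_coe _)
  have hfb : ∀ k, CB k ((1 / 2) ^ k) (f k) := fun k => by
    refine ((hM k).mul (contDiff_coe _) (contDiff_coe _) (hg k)).mono (le_of_eq ?_)
    have := hM1 k
    simp only [a]
    field_simp
  have hf0 : ∀ k y, y ∉ Metric.closedBall (c k) (s k / 10) → f k y = 0 := fun k y hy => by
    simp only [f]
    rw [image_eq_zero_of_notMem_tsupport fun h => hy (hχs k h), zero_mul]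
  have hFs : ContDiff ℝ ∞ fun y => ∑' k, f k y := by
    -- The derivative of order `l` is controlled only for `k ≥ l`, which suffices for convergence.
    refine contDiff_tsum_of_eventually (v := fun _ k => (1 / 2 : ℝ) ^ k) hfs
      (fun _ _ => summable_geometric_two) fun l _ => ?_
    rw [Nat.cofinite_eq_atTop]
    filter_upwards [eventually_ge_atTop l] with k hk y
    exact hfb k l hk y
  have hFc : HasCompactSupport fun y => ∑' k, f k y := by
    refine HasCompactSupport.intro (isCompact_closedBall x₀ R) fun y hy => ?_
    have : ∀ k, f k y = 0 := fun k => hf0 k y fun h => hy (hball k h)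
    simp [this]
  let F : 𝓢(E, ℂ) := hFc.toSchwartzMap hFs
  have hFx : ∀ k, ∀ᶠ z in 𝓝 (x k), F z = g k z := fun k => by
    filter_upwards [Metric.isOpen_ball.mem_nhds (hx k)] with z hz
    change ∑' k, f k z = g k z
    rw [tsum_eq_single k]
    · simp only [f]
      rw [hχ1 k z (Metric.ball_subset_closedBall hz), one_mul]
    · intro l hl
      refine hf0 l z fun h => ?_
      rw [Metric.mem_ball] at hz
      rw [Metric.mem_closedBall] at h
      have h3 := dist_triangle_left (c k) (c l) z
      have h1 := hs0 k
      have h2 := hs0 l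
      rcases lt_or_gt_of_ne hl with hlt | hlt
      · have := hcd l k hlt
        have := hmono l k hlt
        have h4 := dist_comm (c l) (c k)
        linarith
      · have := hcd k l hlt
        have := hmono k l hlt
        linarith
  obtain ⟨C, hC⟩ := hb F x₀ R
  obtain ⟨k, hk⟩ := exists_nat_ge C
  have h1 := hQ k
  rw [← hloc _ _ _ (hFx k)] at h1
  have h2 := hC (x k) (hball k (by
    have := hx k
    rw [Metric.mem_ball] at this
    rw [Metric.mem_closedBall]
    have := hs0 k
    linarith))
  linarith

end SchwartzMul

/-! ### Absolute values: the image of a germ has modulus a power of its modulus -/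

namespace SchwartzMul

open Filter Topology

section General

theorem continuous_of_bounded {V W : Type*} [NormedAddCommGroup V] [NormedSpace ℝ V]
    [NormedAddCommGroup W] [NormedSpace ℝ W] (f : V →+ W) {C : ℝ} (h : ∀ v, ‖v‖ ≤ 1 → ‖f v‖ ≤ C) :
    Continuous f := by
  refine (uniformContinuous_of_continuousAt_zero f ?_).continuous
  rw [Metric.continuousAt_iff]
  intro ε hε
  obtain ⟨k, hk⟩ := exists_nat_gt (C / ε)
  have hC : 0 ≤ C := (norm_nonneg _).trans (h 0 (by simp))
  have hk0 : (0 : ℝ) < k := lt_of_le_of_lt (div_nonneg hC hε.le) hk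
  refine ⟨1 / k, by positivity, fun {v} hv => ?_⟩
  rw [dist_zero_right] at hv
  rw [map_zero, dist_zero_right]
  have h1 : ‖f (k • v)‖ ≤ C := h _ (by
    rw [← Nat.cast_smul_eq_nsmul ℝ, norm_smul, Real.norm_natCast]
    rw [lt_div_iff₀ hk0] at hv
    linarith)
  rw [map_nsmul, ← Nat.cast_smul_eq_nsmul ℝ, norm_smul, Real.norm_natCast] at h1
  rw [div_lt_iff₀ hε] at hk
  nlinarith

theorem map_smul_of_bounded {V W : Type*} [NormedAddCommGroup V] [NormedSpace ℝ V]
    [NormedAddCommGroup W] [NormedSpace ℝ W] (f : V → W) (hf : ∀ v w, f (v + w) = f v + f w)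
    {C : ℝ} (h : ∀ v, ‖v‖ ≤ 1 → ‖f v‖ ≤ C) (t : ℝ) (v : V) : f (t • v) = t • f v :=
  map_real_smul (AddMonoidHom.mk' f hf) (continuous_of_bounded (AddMonoidHom.mk' f hf) h) t v

theorem le_one_of_pow_mul_le {a b C : ℝ} (hb : 0 < b)
    (h : ∀ᶠ k : ℕ in atTop, a ^ k * b ≤ C) : a ≤ 1 := by
  by_contra! ha
  have h1 : Tendsto (fun k : ℕ => a ^ k * b) atTop atTop :=
    (tendsto_pow_atTop_atTop_of_one_lt ha).atTop_mul_const hb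
  obtain ⟨k, hk, hk'⟩ := (h.and (h1.eventually_gt_atTop C)).exists
  linarith

/-- After taking logarithms, the exponent `2 ^ i` of `a` outgrows the linear exponent of `b`. -/
theorem le_one_of_pow_two_pow_le {a b C : ℝ} (hb : 0 < b) (N j : ℕ)
    (h : ∀ i : ℕ, a ^ (2 ^ i) * b ^ (N * i + j) ≤ C) : a ≤ 1 := by
  by_contra! ha
  have hC : 0 < C := lt_of_lt_of_le (by positivity) (h 0)
  have h1 : ∀ i : ℕ, Real.log a ≤
      (Real.log C - j * Real.log b) * (1 / 2 ^ i) - N * Real.log b * (i ^ 1 / 2 ^ i) := fun i => by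
    have h2 := Real.log_le_log (by positivity) (h i)
    rw [Real.log_mul (by positivity) (by positivity), Real.log_pow, Real.log_pow] at h2
    push_cast at h2
    have h3 : (0 : ℝ) < 2 ^ i := by positivity
    have : (Real.log C - j * Real.log b) * (1 / 2 ^ i) - N * Real.log b * (i ^ 1 / 2 ^ i)
      = (Real.log C - j * Real.log b - N * i * Real.log b) / 2 ^ i := by field_simp
    rw [this, le_div_iff₀ h3]
    linarith
  have t1 : Tendsto (fun i : ℕ => (1 : ℝ) / 2 ^ i) atTop (𝓝 0) := by
    simpa using tendsto_pow_atTop_nhds_zero_of_lt_one (r := (1 / 2 : ℝ)) (by norm_num) (by norm_num)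
  have t2 : Tendsto (fun i : ℕ => (i : ℝ) ^ 1 / 2 ^ i) atTop (𝓝 0) :=
    tendsto_pow_const_div_const_pow_of_one_lt 1 (by norm_num)
  have t3 := (t1.const_mul (Real.log C - j * Real.log b)).sub (t2.const_mul (N * Real.log b))
  have h4 := ge_of_tendsto' t3 h1
  have h5 := Real.log_pos ha
  simp at h4
  linarith

theorem eq_of_frequently_eq {X Y : Type*} [TopologicalSpace X] [TopologicalSpace Y] [T2Space Y]
    {f g : X → Y} {x : X} (hf : ContinuousAt f x) (hg : ContinuousAt g x)
    (h : ∃ᶠ z in 𝓝 x, f z = g z) : f x = g x := by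
  by_contra hne
  obtain ⟨z, hz, hz'⟩ := (h.and_eventually ((hf.prodMk hg).eventually
    ((isClosed_diagonal.isOpen_compl).mem_nhds (show (f x, g x) ∈ (Set.diagonal Y)ᶜ from hne)))).exists
  exact hz' hz

end General

variable {E : Type} [NormedAddCommGroup E] [InnerProductSpace ℝ E]

section IsSm

variable {F G : E → ℂ} {x : E}

theorem IsSm.contDiffAt (h : IsSm F x) : ContDiffAt ℝ ∞ F x := h.self_of_nhds

theorem IsSm.mul (hF : IsSm F x) (hG : IsSm G x) : IsSm (fun y => F y * G y) x :=
  (hF.and hG).mono fun _ h => h.1.mul h.2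

theorem IsSm.add (hF : IsSm F x) (hG : IsSm G x) : IsSm (fun y => F y + G y) x :=
  (hF.and hG).mono fun _ h => h.1.add h.2

theorem IsSm.sub (hF : IsSm F x) (hG : IsSm G x) : IsSm (fun y => F y - G y) x :=
  (hF.and hG).mono fun _ h => h.1.sub h.2

theorem isSm_const (c : ℂ) : IsSm (fun _ : E => c) x := contDiff_const.isSm x

theorem IsSm.inv (hF : IsSm F x) (h0 : F x ≠ 0) : IsSm (fun y => (F y)⁻¹) x :=
  (hF.and (hF.contDiffAt.continuousAt.eventually_ne h0)).mono fun _ h => h.1.inv h.2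

theorem IsSm.pow (hF : IsSm F x) (k : ℕ) : IsSm (fun y => F y ^ k) x :=
  hF.mono fun _ h => h.pow k

theorem IsSm.log (hF : IsSm F x) (h0 : F x = 1) : IsSm (fun y => Complex.log (F y)) x := by
  have h1 : ∀ᶠ y in 𝓝 x, F y ∈ Complex.slitPlane :=
    hF.contDiffAt.continuousAt.eventually
      (Complex.isOpen_slitPlane.mem_nhds (by rw [h0]; exact Complex.one_mem_slitPlane))
  filter_upwards [hF, h1] with y hy hy'
  exact (Complex.contDiffAt_log (n := ∞) hy').restrict_scalars ℝ |>.comp y hy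

theorem isSm_schwartz (g : 𝓢(E, ℂ)) : IsSm g x := (contDiff_coe g).isSm x

end IsSm

open Classical in
/-- A Schwartz function with the same germ at `x` as `F`, if there is one. -/
noncomputable def rep (x : E) (F : E → ℂ) : 𝓢(E, ℂ) :=
  if h : ∃ g : 𝓢(E, ℂ), ∀ᶠ y in 𝓝 x, g y = F y then h.choose else 0

variable [FiniteDimensional ℝ E]

theorem IsSm.rep_eq {x : E} {F : E → ℂ} (h : IsSm F x) : ∀ᶠ y in 𝓝 x, rep x F y = F y := by
  obtain ⟨g, -, hg⟩ := h.exists_eq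
  have h' : ∃ g : 𝓢(E, ℂ), ∀ᶠ y in 𝓝 x, g y = F y := ⟨g, hg⟩
  rw [rep, dif_pos h']
  exact h'.choose_spec

/-- The value at `u x` of the image of the germ of `F` at `x`. -/
noncomputable def ev (T : 𝓢(E, ℂ) ≃ 𝓢(E, ℂ)) (u : E → E) (x : E) (F : E → ℂ) : ℂ :=
  T (rep x F) (u x)

section Ev

variable {T : 𝓢(E, ℂ) ≃ 𝓢(E, ℂ)} {u : E → E} {x : E} {F G : E → ℂ}

theorem ev_eq (hT : MulPres T) (hu : Corr T x (u x)) {g : 𝓢(E, ℂ)}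
    (h : ∀ᶠ y in 𝓝 x, g y = F y) : ev T u x F = T g (u x) := by
  have hF : IsSm F x := by
    filter_upwards [h.eventually_nhds] with y hy
    exact (contDiff_coe g).contDiffAt.congr_of_eventuallyEq (hy.mono fun _ h => h.symm)
  refine (hu.eventually_eq hT ?_).self_of_nhds
  filter_upwards [hF.rep_eq, h] with y h1 h2
  rw [h1, h2]

theorem ev_congr (hT : MulPres T) (hu : Corr T x (u x)) (hG : IsSm G x)
    (h : ∀ᶠ y in 𝓝 x, F y = G y) : ev T u x F = ev T u x G := by
  refine ev_eq hT hu ?_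
  filter_upwards [hG.rep_eq, h] with y h1 h2
  rw [h1, h2]

theorem ev_mul (hT : MulPres T) (hu : Corr T x (u x)) (hF : IsSm F x) (hG : IsSm G x) :
    ev T u x (fun y => F y * G y) = ev T u x F * ev T u x G := by
  have h : ∀ᶠ y in 𝓝 x, sm (rep x F) (rep x G) y = F y * G y := by
    filter_upwards [hF.rep_eq, hG.rep_eq] with y h1 h2
    rw [sm_apply, h1, h2]
  rw [ev_eq hT hu h, hT]
  rfl

theorem ev_one (hT : MulPres T) (hu : Corr T x (u x)) : ev T u x (fun _ => 1) = 1 :=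
  (hu.eventually_one hT (isSm_const 1).rep_eq).self_of_nhds

theorem ev_pow (hT : MulPres T) (hu : Corr T x (u x)) (hF : IsSm F x) (k : ℕ) :
    ev T u x (fun y => F y ^ k) = ev T u x F ^ k := by
  induction k with
  | zero => simpa using ev_one hT hu
  | succ k ih => simp_rw [pow_succ]; rw [ev_mul hT hu (hF.pow k) hF, ih]

theorem ev_mul_inv (hT : MulPres T) (hu : Corr T x (u x)) (hF : IsSm F x) (h0 : F x ≠ 0) :
    ev T u x F * ev T u x (fun y => (F y)⁻¹) = 1 := by
  rw [← ev_mul hT hu hF (hF.inv h0), ← ev_one hT hu]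
  refine ev_congr hT hu (isSm_const 1) ?_
  filter_upwards [hF.contDiffAt.continuousAt.eventually_ne h0] with y hy
  exact mul_inv_cancel₀ hy

theorem ev_ne_zero (hT : MulPres T) (hu : Corr T x (u x)) (hF : IsSm F x) (h0 : F x ≠ 0) :
    ev T u x F ≠ 0 := fun h => by
  have := ev_mul_inv hT hu hF h0
  rw [h, zero_mul] at this
  exact zero_ne_one this

/-- A quantitative continuity of evaluation at one point. -/
def EvBound (T : 𝓢(E, ℂ) ≃ 𝓢(E, ℂ)) (u : E → E) (x : E) (N : ℕ) (δ C : ℝ) : Prop :=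
  0 < δ ∧ ∀ g : 𝓢(E, ℂ), CB N δ g → ‖T g (u x)‖ ≤ C

variable {N : ℕ} {δ C : ℝ}

theorem EvBound.norm_ev_le_one (hB : EvBound T u x N δ C) (hT : MulPres T) (hu : Corr T x (u x))
    (hF : IsSm F x) (h1 : F x = 1) : ‖ev T u x F‖ ≤ 1 := by
  -- Near `x` the power `F ^ (2 ^ i)` is `exp (2 ^ i φ)` with `φ x = 0`. Replacing `exp` by a
  -- Schwartz function `e` with the same germ at zero makes the `C^N` norm grow only like `2 ^ (N
  -- i)`, which the factor `(1/2) ^ (N i + j)` compensates.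
  obtain ⟨φ, -, hφ⟩ := (hF.log h1).exists_eq
  obtain ⟨e, -, he⟩ := (Complex.contDiff_exp (n := ∞) (𝕜 := ℝ)).isSm (0 : ℂ) |>.exists_eq
  obtain ⟨χ, hχc, -, hχ⟩ := exists_cutoff (univ_mem : Set.univ ∈ 𝓝 x)
  obtain ⟨A, hA1, hA⟩ := CB.of_schwartz N φ
  obtain ⟨B, hB1, hB'⟩ := CB.of_schwartz N e
  obtain ⟨M, hM1, hM⟩ := CB.of_schwartz N χ
  set K := 2 ^ N * M * (N.factorial * B * A ^ N) with hK
  have hK0 : 0 < K := by positivity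
  obtain ⟨j, hj⟩ := pow_unbounded_of_one_lt (K / δ) (one_lt_two)
  have hφ0 : φ x = 0 := by rw [hφ.self_of_nhds, h1, Complex.log_one]
  have hFne := hF.contDiffAt.continuousAt.eventually_ne (y := 0) (h1 ▸ one_ne_zero)
  refine le_one_of_pow_two_pow_le (b := ‖ev T u x fun _ => 1 / 2‖) (C := C)
    (norm_pos_iff.2 (ev_ne_zero hT hu (isSm_const _) (by norm_num))) N j fun i => ?_
  have hes : ContDiff ℝ ∞ fun y => e ((2 : ℝ) ^ i * φ y : ℂ) :=
    (contDiff_coe e).comp (contDiff_const.mul (contDiff_coe φ))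
  have hgc : HasCompactSupport fun y => (1 / 2 : ℂ) ^ (N * i + j) *
      (χ y * e (((2 : ℝ) ^ i : ℝ) * φ y)) := (hχc.mul_right).mul_left
  have hgs : ContDiff ℝ ∞ fun y => (1 / 2 : ℂ) ^ (N * i + j) *
      (χ y * e (((2 : ℝ) ^ i : ℝ) * φ y)) :=
    contDiff_const.mul ((contDiff_coe χ).mul (by push_cast; exact_mod_cast hes))
  let g := hgc.toSchwartzMap hgs
  have hgx : ∀ᶠ y in 𝓝 x, g y = (1 / 2 : ℂ) ^ (N * i + j) * F y ^ (2 ^ i) := by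
    have ht : Tendsto (fun y => (((2 : ℝ) ^ i : ℝ) * φ y : ℂ)) (𝓝 x) (𝓝 0) := by
      have : Continuous (fun y => (((2 : ℝ) ^ i : ℝ) * φ y : ℂ)) :=
        continuous_const.mul φ.continuous
      simpa [hφ0] using this.tendsto x
    filter_upwards [ht.eventually he, hφ, hχ, hFne] with y h2 h3 h4 h5
    change (1 / 2 : ℂ) ^ (N * i + j) * (χ y * e (((2 : ℝ) ^ i : ℝ) * φ y)) = _
    rw [h4, h2, h3, one_mul]
    push_cast
    rw [show ((2 : ℂ) ^ i) = ((2 ^ i : ℕ) : ℂ) by push_cast; rfl, Complex.exp_nat_mul,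
      Complex.exp_log h5]
  have hgB : CB N δ g := by
    have h2 := ((hM.mul (contDiff_coe _) (by exact_mod_cast hes)
      (CB.comp_mul (contDiff_coe e) (contDiff_coe φ) hB' hA hA1
      (one_le_pow₀ (n := i) (one_le_two (α := ℝ))))).const_mul
      ((contDiff_coe χ).mul (by exact_mod_cast hes)) ((1 / 2 : ℂ) ^ (N * i + j)))
    refine CB.mono h2 ?_
    rw [norm_pow, norm_div, norm_one, Complex.norm_ofNat]
    rw [div_lt_iff₀ hB.1] at hj
    have h3 : ((1 : ℝ) / 2) ^ (N * i + j) * (2 ^ N * M * (N.factorial * B * A ^ N * (2 ^ i) ^ N))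
        = K / 2 ^ j := by
      rw [hK, pow_add, one_div, inv_pow, inv_pow, ← pow_mul, mul_comm i N]
      field_simp
    rw [h3, div_le_iff₀ (by positivity)]
    linarith
  have h6 := hB.2 g hgB
  rw [← ev_eq hT hu hgx, ev_mul hT hu (isSm_const _) (hF.pow _), ev_pow hT hu hF,
    ev_pow hT hu (isSm_const _), norm_mul, norm_pow, norm_pow, mul_comm] at h6
  exact h6

theorem EvBound.norm_ev_eq_one (hB : EvBound T u x N δ C) (hT : MulPres T) (hu : Corr T x (u x))
    (hF : IsSm F x) (h1 : F x = 1) : ‖ev T u x F‖ = 1 := by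
  have h0 : F x ≠ 0 := by rw [h1]; exact one_ne_zero
  have h2 := hB.norm_ev_le_one hT hu hF h1
  have h3 := hB.norm_ev_le_one hT hu (hF.inv h0) (by rw [h1, inv_one])
  have h4 := congrArg norm (ev_mul_inv hT hu hF h0)
  rw [norm_mul, norm_one] at h4
  nlinarith [norm_nonneg (ev T u x F)]

/-- The cut-off constants `c ^ k` tend to zero in `C^N`, so the powers of the value stay bounded. -/
theorem EvBound.norm_const_le_one (hB : EvBound T u x N δ C) (hT : MulPres T)
    (hu : Corr T x (u x)) {c : ℂ} (hc : ‖c‖ < 1) : ‖ev T u x fun _ => c‖ ≤ 1 := by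
  obtain ⟨χ, hχc, -, hχ⟩ := exists_cutoff (univ_mem : Set.univ ∈ 𝓝 x)
  obtain ⟨M, hM1, hM⟩ := CB.of_schwartz N χ
  refine le_one_of_pow_mul_le (C := C) one_pos ?_
  have ht : Tendsto (fun k : ℕ => ‖c‖ ^ k * M) atTop (𝓝 0) := by
    simpa using (tendsto_pow_atTop_nhds_zero_of_lt_one (norm_nonneg c) hc).mul_const M
  filter_upwards [ht.eventually_le_const hB.1] with k hk
  have h2 := hB.2 (c ^ k • χ) (CB.mono (hM.const_mul (contDiff_coe χ) (c ^ k)) (by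
    rwa [norm_pow]))
  rw [← ev_eq hT hu (F := fun _ => c ^ k), ev_pow hT hu (isSm_const c), norm_pow] at h2
  · rwa [mul_one]
  · filter_upwards [hχ] with y hy
    simp [hy]

theorem EvBound.norm_const_eq_one (hB : EvBound T u x N δ C) (hT : MulPres T)
    (hu : Corr T x (u x)) {c : ℂ} (hc : ‖c‖ = 1) : ‖ev T u x fun _ => c‖ = 1 := by
  have key : ∀ c : ℂ, ‖c‖ = 1 → ‖ev T u x fun _ => c‖ ≤ 1 := fun c hc => by
    -- Multiplying by `1/2` keeps `c ^ k / 2` at modulus below one for every `k`, so the previous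
    -- bound applies.
    refine le_one_of_pow_mul_le (C := 1) (b := ‖ev T u x fun _ => 1 / 2‖)
      (norm_pos_iff.2 (ev_ne_zero hT hu (isSm_const _) (by norm_num)))
      (Eventually.of_forall fun k => ?_)
    rw [← norm_pow, ← ev_pow hT hu (isSm_const c), ← norm_mul,
      ← ev_mul hT hu (isSm_const _) (isSm_const _)]
    apply hB.norm_const_le_one hT hu
    rw [norm_mul, norm_pow, hc]
    norm_num
  have h0 : c ≠ 0 := fun h => by simp [h] at hc
  have h4 := congrArg norm (ev_mul_inv hT hu (isSm_const c) h0)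
  rw [norm_mul, norm_one] at h4
  have h2 := key c hc
  have h3 := key c⁻¹ (by rw [norm_inv, hc, inv_one])
  nlinarith [norm_nonneg (ev T u x fun _ => c)]

/-- On positive constants, `log |ev|` is an additive and monotone function of the logarithm, hence
linear. A general germ is a germ of value one times a unimodular constant times a positive constant,
and the first two factors have images of modulus one. -/
theorem EvBound.exists_rpow (hB : EvBound T u x N δ C) (hT : MulPres T) (hu : Corr T x (u x)) :
    ∃ p : ℝ, 0 ≤ p ∧ ∀ F : E → ℂ, IsSm F x → F x ≠ 0 → ‖ev T u x F‖ = ‖F x‖ ^ p := by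
  let e : ℝ → ℂ := fun s => Real.exp s
  have he : ∀ s, e s ≠ 0 := fun s => by simp [e]
  have hpos : ∀ s, 0 < ‖ev T u x fun _ => e s‖ := fun s =>
    norm_pos_iff.2 (ev_ne_zero hT hu (isSm_const _) (he s))
  let L : ℝ → ℝ := fun s => Real.log ‖ev T u x fun _ => e s‖
  have hadd : ∀ s t, L (s + t) = L s + L t := fun s t => by
    simp only [L]
    rw [← Real.log_mul (hpos s).ne' (hpos t).ne', ← norm_mul,
      ← ev_mul hT hu (isSm_const _) (isSm_const _)]
    simp [e, Complex.exp_add]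
  have hneg : ∀ s, s < 0 → L s ≤ 0 := fun s hs => by
    refine Real.log_nonpos (norm_nonneg _) (hB.norm_const_le_one hT hu ?_)
    rw [Complex.norm_real, Real.norm_of_nonneg (Real.exp_pos _).le]
    exact (Real.exp_lt_exp.2 hs).trans_eq Real.exp_zero
  have hL0 : L 0 = 0 := by have := hadd 0 0; simp at this; exact this
  have hmono : Monotone L := fun s t hst => by
    rcases hst.eq_or_lt with h | h
    · rw [h]
    · have h1 := hneg (s - t) (by linarith)
      have h2 := hadd (s - t) t
      rw [sub_add_cancel] at h2
      linarith
  have hlin : ∀ s, L s = s * L 1 := fun s => by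
    have := map_smul_of_bounded L hadd (C := L 1) (fun v hv => by
      rw [Real.norm_eq_abs, abs_le] at *
      have h1 := hmono hv.1
      have h2 := hmono hv.2
      have h3 := hadd 1 (-1)
      rw [add_neg_cancel, hL0] at h3
      constructor <;> linarith) s 1
    simpa using this
  refine ⟨L 1, by rw [← hL0]; exact hmono zero_le_one, fun F hF h0 => ?_⟩
  have hn : 0 < ‖F x‖ := norm_pos_iff.2 h0
  have h1 := hB.norm_ev_eq_one hT hu (F := fun y => F y * (F x)⁻¹) (hF.mul (isSm_const _))
    (mul_inv_cancel₀ h0)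
  have h2 := hB.norm_const_eq_one hT hu (c := F x * (e (Real.log ‖F x‖))⁻¹) (by
    simp only [e]
    rw [norm_mul, norm_inv, Complex.norm_real, Real.exp_log hn, norm_norm, mul_inv_cancel₀ hn.ne'])
  have h3 : ev T u x F = ev T u x (fun y => F y * (F x)⁻¹) *
      (ev T u x (fun _ => F x * (e (Real.log ‖F x‖))⁻¹) *
        ev T u x (fun _ => e (Real.log ‖F x‖))) := by
    rw [← ev_mul hT hu (isSm_const _) (isSm_const _),
      ← ev_mul hT hu (hF.mul (isSm_const _)) (isSm_const _)]
    congr 1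
    funext y
    have := he (Real.log ‖F x‖)
    field_simp
  rw [h3, norm_mul, norm_mul, h1, h2, one_mul, one_mul, Real.rpow_def_of_pos hn, ← hlin,
    Real.exp_log (hpos _)]

end Ev

theorem MulPres.exists_rpow [Nontrivial E] {T : 𝓢(E, ℂ) ≃ 𝓢(E, ℂ)} (hT : MulPres T) {u : E ≃ₜ E}
    (hu : ∀ x, Corr T x (u x)) :
    ∃ p : E → ℝ, Continuous p ∧ (∀ x, 0 ≤ p x) ∧
      (∀ x F, IsSm F x → F x ≠ 0 → ‖ev T u x F‖ = ‖F x‖ ^ p x) := by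
  have hdense : ∀ x₀, ∃ᶠ x in 𝓝 x₀, ∃ p : ℝ, 0 ≤ p ∧
      ∀ F : E → ℂ, IsSm F x → F x ≠ 0 → ‖ev T u x F‖ = ‖F x‖ ^ p := fun x₀ => by
    rw [(nhds_basis_opens x₀).frequently_iff]
    rintro W ⟨hx, hW⟩
    obtain ⟨z, r, hr, hsub, N, δ, C, hδ, hB⟩ := exists_ball_bound
      (fun x g => ‖T g (u x)‖)
      (fun x f g h => by rw [((hu x).eventually_eq hT h).self_of_nhds])
      (fun g x r => ((isCompact_closedBall x r).exists_bound_of_continuousOn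
        (f := fun z => T g (u z))
        ((T g).continuous.comp u.continuous).continuousOn)) hW ⟨x₀, hx⟩
    exact ⟨z, hsub (Metric.mem_ball_self hr),
      EvBound.exists_rpow ⟨hδ, hB z (Metric.mem_ball_self hr)⟩ hT (hu z)⟩
  have hcont : ∀ x₀ F, IsSm F x₀ → ∀ᶠ x in 𝓝 x₀, ev T u x F = T (rep x₀ F) (u x) :=
    fun x₀ F hF => by
      filter_upwards [hF.rep_eq.eventually_nhds] with x hx
      exact ev_eq hT (hu x) hx
  have hcont' : ∀ x₀ F, IsSm F x₀ → ContinuousAt (fun x => ‖ev T u x F‖) x₀ := fun x₀ F hF => by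
    have h1 : ContinuousAt (fun x => ‖T (rep x₀ F) (u x)‖) x₀ :=
      ((T (rep x₀ F)).continuous.comp u.continuous).norm.continuousAt
    exact h1.congr ((hcont x₀ F hF).mono fun x hx => by simp only [hx])
  -- Reading the exponent off the constant `2` makes it continuous in `x`, so the power law extends
  -- from the dense set of good points.
  let p : E → ℝ := fun x => Real.log ‖ev T u x fun _ => 2‖ / Real.log 2
  have hpc : Continuous p := by
    rw [continuous_iff_continuousAt]
    intro x
    exact ((hcont' x _ (isSm_const 2)).log
      (norm_ne_zero_iff.2 (ev_ne_zero hT (hu x) (isSm_const 2) (by norm_num)))).div_const _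
  have hp : ∀ x (q : ℝ), (∀ F : E → ℂ, IsSm F x → F x ≠ 0 → ‖ev T u x F‖ = ‖F x‖ ^ q) →
      q = p x := fun x q h => by
    simp only [p]
    rw [h _ (isSm_const 2) (by norm_num), Complex.norm_ofNat, Real.log_rpow (by norm_num),
      mul_div_cancel_right₀ _ (Real.log_pos (by norm_num)).ne']
  have hdense' : ∀ x₀, ∃ᶠ x in 𝓝 x₀, 0 ≤ p x ∧
      ∀ F : E → ℂ, IsSm F x → F x ≠ 0 → ‖ev T u x F‖ = ‖F x‖ ^ p x := fun x₀ =>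
    (hdense x₀).mono fun x ⟨q, h1, h2⟩ => by
      rw [← hp x q h2]; exact ⟨h1, h2⟩
  refine ⟨p, hpc, fun x => ?_, fun x F hF h0 => ?_⟩
  · refine eq_of_frequently_eq (f := fun x => min (p x) 0) (g := fun _ => 0)
      (hpc.min continuous_const).continuousAt continuousAt_const
      ((hdense' x).mono fun z hz => min_eq_right hz.1) |> min_eq_right_iff.1
  · refine eq_of_frequently_eq (hcont' x F hF)
      (hF.contDiffAt.continuousAt.norm.rpow hpc.continuousAt
        (Or.inl (norm_ne_zero_iff.2 h0))) ?_
    have h2 : ∀ᶠ z in 𝓝 x, IsSm F z ∧ F z ≠ 0 :=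
      (hF.eventually_nhds).and (hF.contDiffAt.continuousAt.eventually_ne h0)
    exact ((hdense' x).and_eventually h2).mono fun z hz => hz.1.2 F hz.2.1 hz.2.2

end SchwartzMul

/-! ### Smoothness of the homeomorphism, and exponent one -/

namespace SchwartzMul

open Filter Topology

variable {E : Type} [NormedAddCommGroup E] [InnerProductSpace ℝ E] [FiniteDimensional ℝ E]

theorem contDiffAt_of_inner {V : Type*} [NormedAddCommGroup V] [NormedSpace ℝ V] {v : V → E}
    {y : V} (h : ∀ w, ContDiffAt ℝ ∞ (fun z => inner ℝ w (v z)) y) : ContDiffAt ℝ ∞ v y := by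
  have h1 : v = fun z => ∑ i, inner ℝ (stdOrthonormalBasis ℝ E i) (v z) •
      stdOrthonormalBasis ℝ E i := by
    funext z
    exact ((stdOrthonormalBasis ℝ E).sum_repr' (v z)).symm
  rw [h1]
  exact ContDiffAt.sum fun i _ => (h _).smul contDiffAt_const

variable {T : 𝓢(E, ℂ) ≃ 𝓢(E, ℂ)} {u : E ≃ₜ E} {p q : E → ℝ}

/-- For `F = exp ⟨w, ·⟩` the logarithm of the image's modulus is `p x ⟨w, x⟩`, for the constant `2`
it is `p x log 2`. Both are smooth as functions of `y = u x`, because images are Schwartz functions;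
their quotient recovers the coordinate `⟨w, u.symm y⟩`. -/
theorem contDiff_symm_of_rpow (hT : MulPres T) (hu : ∀ x, Corr T x (u x)) (hp0 : ∀ x, p x ≠ 0)
    (hp : ∀ x F, IsSm F x → F x ≠ 0 → ‖ev T u x F‖ = ‖F x‖ ^ p x) : ContDiff ℝ ∞ u.symm := by
  rw [contDiff_iff_contDiffAt]
  intro y₀
  refine contDiffAt_of_inner fun w => ?_
  have key : ∀ F : E → ℂ, (∀ x, IsSm F x) → ∀ᶠ y in 𝓝 y₀,
      T (rep (u.symm y₀) F) y = ev T u (u.symm y) F := fun F hF => by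
    have h1 := (hF (u.symm y₀)).rep_eq.eventually_nhds
    filter_upwards [u.symm.continuous.continuousAt.eventually h1] with y hy
    rw [ev_eq hT (hu _) hy, Homeomorph.apply_symm_apply]
  let F : E → ℂ := fun x => Complex.exp ((inner ℝ w x : ℝ) : ℂ)
  have hF : ∀ x, IsSm F x := fun x => by
    apply ContDiff.isSm
    have h1 : ContDiff ℝ ∞ fun x : E => (inner ℝ w x : ℝ) := contDiff_const.inner ℝ contDiff_id
    exact (Complex.ofRealCLM.contDiff.comp h1).cexp
  have hF0 : ∀ x, F x ≠ 0 := fun x => Complex.exp_ne_zero _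
  have hFn : ∀ x, Real.log ‖ev T u x F‖ = p x * inner ℝ w x := fun x => by
    rw [hp x F (hF x) (hF0 x), Real.log_rpow (norm_pos_iff.2 (hF0 x))]
    simp only [F]
    rw [Complex.norm_exp, Complex.ofReal_re, Real.log_exp]
  have h2n : ∀ x, Real.log ‖ev T u x (fun _ => 2)‖ = p x * Real.log 2 := fun x => by
    rw [hp x _ (isSm_const 2) (by norm_num), Real.log_rpow (by norm_num), Complex.norm_ofNat]
  have hlog : ∀ F : E → ℂ, (∀ x, IsSm F x) → (∀ x, F x ≠ 0) →
      ContDiffAt ℝ ∞ (fun y => Real.log ‖ev T u (u.symm y) F‖) y₀ := fun F hF hF0 => by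
    have h1 : T (rep (u.symm y₀) F) y₀ ≠ 0 := by
      rw [(key F hF).self_of_nhds]
      exact ev_ne_zero hT (hu _) (hF _) (hF0 _)
    refine ((((contDiff_coe (T (rep (u.symm y₀) F))).contDiffAt (x := y₀)).norm ℝ h1).log
      (norm_ne_zero_iff.2 h1)).congr_of_eventuallyEq ?_
    filter_upwards [key F hF] with y hy
    rw [hy]
  have hl2 : Real.log 2 ≠ 0 := (Real.log_pos (by norm_num)).ne'
  have h3 := ((hlog F hF hF0).mul (contDiffAt_const (c := Real.log 2))).div
    (hlog (fun _ => 2) (fun _ => isSm_const _) (fun _ => two_ne_zero))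
    (by rw [h2n]; exact mul_ne_zero (hp0 _) hl2)
  refine h3.congr_of_eventuallyEq (Eventually.of_forall fun y => ?_)
  rw [Pi.div_apply, hFn, h2n]
  have := hp0 (u.symm y)
  field_simp

/-- The constant `2` is sent forth and back. -/
theorem rpow_mul_eq_one (hT : MulPres T) (hu : ∀ x, Corr T x (u x))
    (hv : ∀ y, Corr T.symm y (u.symm y))
    (hp : ∀ x F, IsSm F x → F x ≠ 0 → ‖ev T u x F‖ = ‖F x‖ ^ p x)
    (hq : ∀ y F, IsSm F y → F y ≠ 0 → ‖ev T.symm u.symm y F‖ = ‖F y‖ ^ q y) (x : E) :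
    p x * q (u x) = 1 := by
  have h2 := isSm_const (x := x) (2 : ℂ)
  have h0 := ev_ne_zero hT (hu x) h2 (by norm_num)
  have h3 := hq (u x) (T (rep x fun _ => 2)) (isSm_schwartz _) h0
  rw [ev_eq hT.symm (hv _) (Eventually.of_forall fun _ => rfl), Equiv.symm_apply_apply,
    Homeomorph.symm_apply_apply, h2.rep_eq.self_of_nhds] at h3
  change _ = ‖ev T u x fun _ => 2‖ ^ q (u x) at h3
  rw [hp x _ h2 (by norm_num), Complex.norm_ofNat, ← Real.rpow_mul (by norm_num)] at h3
  have h4 := congrArg Real.log h3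
  rw [Real.log_rpow (by norm_num)] at h4
  have := Real.log_pos (one_lt_two)
  nlinarith

theorem map_eq_zero_of_rpow (hT : MulPres T) (hv : ∀ y, Corr T.symm y (u.symm y))
    (hq : ∀ y F, IsSm F y → F y ≠ 0 → ‖ev T.symm u.symm y F‖ = ‖F y‖ ^ q y)
    {x : E} {f : 𝓢(E, ℂ)} (hf : f x = 0) : T f (u x) = 0 := by
  by_contra h
  have h3 := hq (u x) (T f) (isSm_schwartz _) h
  rw [ev_eq hT.symm (hv _) (Eventually.of_forall fun _ => rfl), Equiv.symm_apply_apply,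
    Homeomorph.symm_apply_apply, hf, norm_zero] at h3
  exact (Real.rpow_pos_of_pos (norm_pos_iff.2 h) _).ne h3

/-- A linear function with a simple zero at `x` has an image of modulus `t ^ p` at distance `t`
along `e`, with `p` evaluated at the moving point. The image is differentiable with a zero, so `t ^
p ≤ K t`, impossible for small `t` if `p x < 1`. -/
theorem one_le_of_rpow [Nontrivial E] (hT : MulPres T) (hu : ∀ x, Corr T x (u x))
    (hv : ∀ y, Corr T.symm y (u.symm y)) (hpc : Continuous p)
    (hp : ∀ x F, IsSm F x → F x ≠ 0 → ‖ev T u x F‖ = ‖F x‖ ^ p x)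
    (hq : ∀ y F, IsSm F y → F y ≠ 0 → ‖ev T.symm u.symm y F‖ = ‖F y‖ ^ q y)
    (hus : ContDiff ℝ ∞ u) (x : E) : 1 ≤ p x := by
  by_contra! hlt
  obtain ⟨e, he⟩ := exists_norm_eq E zero_le_one
  let F : E → ℂ := fun y => ((inner ℝ e (y - x) : ℝ) : ℂ)
  have hF : ∀ z, IsSm F z := fun z => by
    apply ContDiff.isSm
    have h1 : ContDiff ℝ ∞ fun y : E => (inner ℝ e (y - x) : ℝ) :=
      contDiff_const.inner ℝ (contDiff_id.sub contDiff_const)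
    exact Complex.ofRealCLM.contDiff.comp h1
  set f := rep x F with hf
  have hfx : f x = 0 := by rw [(hF x).rep_eq.self_of_nhds]; simp [F]
  let W : E → ℂ := fun z => T f (u z)
  have hW0 : W x = 0 := map_eq_zero_of_rpow hT hv hq hfx
  have hWd : DifferentiableAt ℝ W x :=
    ((contDiff_coe (T f)).comp hus).differentiable (by simp) x
  obtain ⟨K, hK⟩ := hWd.hasFDerivAt.isBigO_sub.bound
  have hev : ∀ᶠ z in 𝓝 x, ev T u z F = W z := by
    filter_upwards [(hF x).rep_eq.eventually_nhds] with z hz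
    exact ev_eq hT (hu z) hz
  have hpe : ∀ᶠ z in 𝓝 x, p z < (1 + p x) / 2 :=
    hpc.continuousAt.eventually_lt_const (by linarith)
  have hl : Tendsto (fun t : ℝ => x + t • e) (𝓝[>] 0) (𝓝 x) := by
    have : Continuous (fun t : ℝ => x + t • e) := by fun_prop
    simpa using (this.tendsto 0).mono_left nhdsWithin_le_nhds
  have ha : 0 < (1 - p x) / 2 := by linarith
  have ht : Tendsto (fun t : ℝ => K * t ^ ((1 - p x) / 2)) (𝓝[>] 0) (𝓝 0) := by
    have h1 : ContinuousAt (fun t : ℝ => t ^ ((1 - p x) / 2)) 0 :=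
      Real.continuousAt_rpow_const _ _ (Or.inr ha.le)
    have h2 := (h1.tendsto.const_mul K).mono_left (nhdsWithin_le_nhds (s := Set.Ioi 0))
    simpa [Real.zero_rpow ha.ne'] using h2
  have h1 : ∀ᶠ t : ℝ in 𝓝[>] 0, t < 1 := mem_nhdsWithin_of_mem_nhds (Iio_mem_nhds one_pos)
  obtain ⟨t, ht1, ht0, h2, h3, h4, h5⟩ := (h1.and ((eventually_mem_nhdsWithin (a := (0 : ℝ))).and
    ((hl.eventually hK).and ((hl.eventually hev).and ((hl.eventually hpe).and
      (ht.eventually_lt_const one_pos)))))).exists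
  have ht0' : 0 < t := ht0
  have hFt : F (x + t • e) = t := by simp [F, inner_smul_right, he]
  rw [hW0, sub_zero, add_sub_cancel_left, ← h3, hp _ _ (hF _) (by rw [hFt]; exact_mod_cast ht0'.ne'),
    hFt, Complex.norm_real, norm_smul, he, mul_one, Real.norm_of_nonneg ht0'.le] at h2
  have h6 : t ^ ((1 + p x) / 2) ≤ K * t :=
    (Real.rpow_le_rpow_of_exponent_ge ht0' ht1.le h4.le).trans h2
  have h7 : t = t ^ ((1 - p x) / 2) * t ^ ((1 + p x) / 2) := by
    rw [← Real.rpow_add ht0']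
    ring_nf
    simp
  have h8 : 0 < t ^ ((1 + p x) / 2) := Real.rpow_pos_of_pos ht0' _
  have h9 : t ^ ((1 + p x) / 2) ≤ (K * t ^ ((1 - p x) / 2)) * t ^ ((1 + p x) / 2) := by
    rw [mul_assoc, ← h7]
    exact h6
  nlinarith

/-- A multiplicative bijection of the Schwartz space preserves absolute values up to a
diffeomorphism. -/
theorem MulPres.exists_norm_eq [Nontrivial E] (hT : MulPres T) :
    ∃ u : E ≃ₜ E, (∀ x, Corr T x (u x)) ∧ ContDiff ℝ ∞ u ∧ ContDiff ℝ ∞ u.symm ∧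
      ∀ f x, ‖T f (u x)‖ = ‖f x‖ := by
  obtain ⟨u, hu, hv⟩ := hT.exists_homeomorph
  obtain ⟨p, hpc, hp0, hp⟩ := hT.exists_rpow hu
  obtain ⟨q, hqc, hq0, hq⟩ := hT.symm.exists_rpow (u := u.symm) hv
  have hpq := rpow_mul_eq_one hT hu hv hp hq
  have hqp := rpow_mul_eq_one hT.symm (u := u.symm) hv hu hq hp
  have hvs := contDiff_symm_of_rpow hT hu (fun x h => by simpa [h] using hpq x) hp
  have hus : ContDiff ℝ ∞ u :=
    contDiff_symm_of_rpow hT.symm (u := u.symm) hv (fun x h => by simpa [h] using hqp x) hq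
  have hp1 := one_le_of_rpow hT hu hv hpc hp hq hus
  have hq1 := one_le_of_rpow hT.symm (u := u.symm) hv hu hqc hq hp hvs
  have hp1' : ∀ x, p x = 1 := fun x => by
    have h1 := hp1 x
    have h2 := hq1 (u x)
    have h3 := hpq x
    nlinarith
  refine ⟨u, hu, hus, hvs, fun f x => ?_⟩
  by_cases hf : f x = 0
  · rw [hf, map_eq_zero_of_rpow hT hv hq hf]
  · rw [← ev_eq hT (hu x) (F := f) (Eventually.of_forall fun _ => rfl),
      hp x f (isSm_schwartz f) hf, hp1' x, Real.rpow_one]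

end SchwartzMul

/-! ### Second order Taylor formula with smooth remainder -/

namespace SchwartzMul

open Filter Topology

variable {E : Type} [NormedAddCommGroup E] [InnerProductSpace ℝ E]

/-- The weight `t ^ k` and the free target `G` let the induction close: differentiating in `y`
replaces `g` by its derivative and `k` by `k + 1`. -/
theorem contDiff_integral_segment [FiniteDimensional ℝ E] (x : E) (n : ℕ) {G : Type} [NormedAddCommGroup G] [NormedSpace ℝ G]
    [CompleteSpace G] (g : E → G) (hg : ContDiff ℝ ∞ g) (k : ℕ) :
    ContDiff ℝ n fun y => ∫ t in (0 : ℝ)..1, t ^ k • g (x + t • (y - x)) := by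
  induction n generalizing G k with
  | zero =>
    rw [Nat.cast_zero, contDiff_zero]
    apply intervalIntegral.continuous_parametric_intervalIntegral_of_continuous'
    have := hg.continuous
    fun_prop
  | succ n ih =>
    have hg' : ContDiff ℝ ∞ (fderiv ℝ g) := hg.fderiv_right (by simp)
    push_cast
    rw [contDiff_succ_iff_hasFDerivAt]
    refine ⟨_, ih (fderiv ℝ g) hg' (k + 1), fun y₀ => ?_⟩
    have hc : Continuous fun z : ℝ × E => z.1 ^ (k + 1) • fderiv ℝ g (x + z.1 • (z.2 - x)) := by
      have := hg'.continuous
      fun_prop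
    obtain ⟨C, hC⟩ := ((isCompact_Icc (a := (0 : ℝ)) (b := 1)).prod
      (isCompact_closedBall y₀ 1)).exists_bound_of_continuousOn hc.continuousOn
    have hgc := hg.continuous
    refine intervalIntegral.hasFDerivAt_integral_of_dominated_of_fderiv_le
      (F' := fun y t => t ^ (k + 1) • fderiv ℝ g (x + t • (y - x))) (bound := fun _ => C)
      (Metric.closedBall_mem_nhds y₀ one_pos) ?_ ?_ ?_ ?_ ?_ ?_
    · refine Eventually.of_forall fun y => Continuous.aestronglyMeasurable ?_
      fun_prop
    · refine Continuous.intervalIntegrable ?_ _ _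
      fun_prop
    · have h2 : Continuous fun t : ℝ => t ^ (k + 1) • fderiv ℝ g (x + t • (y₀ - x)) :=
        hc.comp (Continuous.prodMk_left y₀)
      exact h2.aestronglyMeasurable
    · refine Eventually.of_forall fun t ht y hy => hC (t, y) ⟨?_, hy⟩
      rw [Set.uIoc_of_le zero_le_one] at ht
      exact ⟨ht.1.le, ht.2⟩
    · exact intervalIntegrable_const
    · refine Eventually.of_forall fun t _ y _ => ?_
      have h1 : HasFDerivAt (fun y => x + t • (y - x)) (t • ContinuousLinearMap.id ℝ E) y :=
        (((hasFDerivAt_id y).sub_const x).const_smul t).const_add x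
      have h2 := (((hg.differentiable (by simp) (x + t • (y - x))).hasFDerivAt).comp y h1).const_smul
        (t ^ k)
      have h3 : t ^ (k + 1) • fderiv ℝ g (x + t • (y - x)) =
          t ^ k • (fderiv ℝ g (x + t • (y - x))).comp (t • ContinuousLinearMap.id ℝ E) := by
        ext w
        simp [pow_succ, mul_smul]
      rw [h3]
      exact h2

theorem exists_taylor_two [FiniteDimensional ℝ E] (x : E) {f : E → ℂ} (hf : ContDiff ℝ ∞ f) :
    ∃ k : Fin (Module.finrank ℝ E) → E → ℂ, (∀ i, ContDiff ℝ ∞ (k i)) ∧ (∀ i, k i x = 0) ∧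
      ∀ y, f y = f x + fderiv ℝ f x (y - x) +
        ∑ i, ((inner ℝ (stdOrthonormalBasis ℝ E i) (y - x) : ℝ) : ℂ) * k i y := by
  have hf' : ContDiff ℝ ∞ (fderiv ℝ f) := hf.fderiv_right (by simp)
  -- Hadamard's lemma: `f y = f x + h y (y - x)` with `h` smooth and `h x` the derivative at `x`;
  -- the `k i` are the coordinates of `h y - h x`.
  let h : E → E →L[ℝ] ℂ := fun y => ∫ t in (0 : ℝ)..1, fderiv ℝ f (x + t • (y - x))
  have hh : ContDiff ℝ ∞ h := by
    rw [contDiff_infty]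
    intro n
    simpa using contDiff_integral_segment x n _ hf' 0
  have hx : h x = fderiv ℝ f x := by simp [h]
  have hfh : ∀ y, f y = f x + h y (y - x) := fun y => by
    have h1 : ∀ t : ℝ, HasDerivAt (fun t : ℝ => f (x + t • (y - x)))
        (fderiv ℝ f (x + t • (y - x)) (y - x)) t := fun t => by
      have h2 : HasDerivAt (fun t : ℝ => x + t • (y - x)) (y - x) t := by
        simpa using ((hasDerivAt_id t).smul_const (y - x)).const_add x
      exact (hf.differentiable (by simp) _).hasFDerivAt.comp_hasDerivAt t h2
    have hc : Continuous fun t : ℝ => fderiv ℝ f (x + t • (y - x)) := by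
      have := hf'.continuous
      fun_prop
    have h3 := intervalIntegral.integral_eq_sub_of_hasDerivAt (a := 0) (b := 1)
      (fun t _ => h1 t) ((hc.clm_apply continuous_const).intervalIntegrable _ _)
    rw [← ContinuousLinearMap.intervalIntegral_apply (hc.intervalIntegrable _ _)] at h3
    simp only [h]
    rw [h3]
    simp
  refine ⟨fun i y => (h y - h x) (stdOrthonormalBasis ℝ E i), fun i => ?_, fun i => by simp,
    fun y => ?_⟩
  · exact (hh.sub contDiff_const).clm_apply contDiff_const
  · have h1 : (h y - h x) (y - x) = ∑ i, ((inner ℝ (stdOrthonormalBasis ℝ E i) (y - x) : ℝ) : ℂ) *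
        (h y - h x) (stdOrthonormalBasis ℝ E i) := by
      conv_lhs => rw [← (stdOrthonormalBasis ℝ E).sum_repr' (y - x)]
      rw [map_sum]
      refine Finset.sum_congr rfl fun i _ => ?_
      rw [map_smul, Complex.real_smul]
    rw [← h1, hfh y, ← hx, sub_apply]
    ring

end SchwartzMul

/-! ### The logarithmic derivative and its finite order -/

namespace SchwartzMul

open Filter Topology

variable {E : Type} [NormedAddCommGroup E] [InnerProductSpace ℝ E]

theorem IsSm.sum {ι : Type*} {F : ι → E → ℂ} {x : E} (s : Finset ι) (h : ∀ i ∈ s, IsSm (F i) x) :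
    IsSm (fun y => ∑ i ∈ s, F i y) x :=
  ((Filter.eventually_all_finset s).2 h).mono fun _ hy => ContDiffAt.sum hy

theorem CB.sum {ι : Type*} {N : ℕ} {C : ι → ℝ} {F : ι → E → ℂ} (s : Finset ι)
    (hF : ∀ i, ContDiff ℝ ∞ (F i)) (h : ∀ i, CB N (C i) (F i)) :
    CB N (∑ i ∈ s, C i) (fun y => ∑ i ∈ s, F i y) := by
  classical
  induction s using Finset.induction_on with
  | empty =>
    intro l _ y
    simp only [Finset.sum_empty]
    rw [iteratedFDeriv_fun_zero]
    simp
  | insert i s hi ih =>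
    simp only [Finset.sum_insert hi]
    exact (h i).add (hF i) (ContDiff.sum fun j _ => hF j) ih

theorem contDiff_comp_map {T : 𝓢(E, ℂ) ≃ 𝓢(E, ℂ)} {u : E → E} (hus : ContDiff ℝ ∞ u)
    (g : 𝓢(E, ℂ)) :
    ContDiff ℝ ∞ fun z => T g (u z) := (contDiff_coe (T g)).comp hus

variable [FiniteDimensional ℝ E]

/-- The logarithmic derivative at `x` in direction `e` of the image of the germ of `F`. -/
noncomputable def ld (T : 𝓢(E, ℂ) ≃ 𝓢(E, ℂ)) (u : E → E) (e x : E) (F : E → ℂ) : ℂ :=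
  fderiv ℝ (fun z => T (rep x F) (u z)) x e / ev T u x F

section Ld

variable {T : 𝓢(E, ℂ) ≃ 𝓢(E, ℂ)} {u : E → E} {e x : E} {F G : E → ℂ}

theorem eventually_map_eq (hT : MulPres T) (hu : ∀ x, Corr T x (u x)) {f g : 𝓢(E, ℂ)}
    (h : ∀ᶠ y in 𝓝 x, f y = g y) : (fun z => T f (u z)) =ᶠ[𝓝 x] fun z => T g (u z) := by
  filter_upwards [h.eventually_nhds] with z hz
  exact ((hu z).eventually_eq hT hz).self_of_nhds

theorem ld_eq (hT : MulPres T) (hu : ∀ x, Corr T x (u x)) {g : 𝓢(E, ℂ)}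
    (h : ∀ᶠ y in 𝓝 x, g y = F y) :
    ld T u e x F = fderiv ℝ (fun z => T g (u z)) x e / T g (u x) := by
  have hF : IsSm F x := by
    filter_upwards [h.eventually_nhds] with y hy
    exact (contDiff_coe g).contDiffAt.congr_of_eventuallyEq (hy.mono fun _ h => h.symm)
  rw [ld, ev_eq hT (hu x) h]
  congr 2
  refine Filter.EventuallyEq.fderiv_eq (eventually_map_eq hT hu ?_)
  filter_upwards [hF.rep_eq, h] with y h1 h2
  rw [h1, h2]

theorem ld_congr (hT : MulPres T) (hu : ∀ x, Corr T x (u x)) (hG : IsSm G x)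
    (h : ∀ᶠ y in 𝓝 x, F y = G y) : ld T u e x F = ld T u e x G := by
  have h1 : ∀ᶠ y in 𝓝 x, rep x G y = F y := by
    filter_upwards [hG.rep_eq, h] with y h1 h2
    rw [h1, h2]
  rw [ld_eq hT hu h1, ld_eq hT hu hG.rep_eq]

theorem ld_mul (hT : MulPres T) (hu : ∀ x, Corr T x (u x)) (hus : ContDiff ℝ ∞ u) (hF : IsSm F x)
    (hG : IsSm G x) (hF0 : F x ≠ 0) (hG0 : G x ≠ 0) :
    ld T u e x (fun y => F y * G y) = ld T u e x F + ld T u e x G := by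
  have h : ∀ᶠ y in 𝓝 x, sm (rep x F) (rep x G) y = F y * G y := by
    filter_upwards [hF.rep_eq, hG.rep_eq] with y h1 h2
    rw [sm_apply, h1, h2]
  have hF1 : T (rep x F) (u x) ≠ 0 := ev_ne_zero hT (hu x) hF hF0
  have hG1 : T (rep x G) (u x) ≠ 0 := ev_ne_zero hT (hu x) hG hG0
  have hd : ∀ g : 𝓢(E, ℂ), DifferentiableAt ℝ (fun z => T g (u z)) x := fun g =>
    (contDiff_comp_map hus g).differentiable (by simp) x
  rw [ld_eq hT hu h, ld_eq hT hu hF.rep_eq, ld_eq hT hu hG.rep_eq, hT]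
  simp only [sm_apply]
  rw [fderiv_fun_mul (hd _) (hd _)]
  simp only [add_apply, smul_apply, smul_eq_mul]
  field_simp
  ring

theorem ld_one (hT : MulPres T) (hu : ∀ x, Corr T x (u x)) (hus : ContDiff ℝ ∞ u) :
    ld T u e x (fun _ => 1) = 0 := by
  have h := ld_mul (e := e) hT hu hus (isSm_const (x := x) 1) (isSm_const 1) one_ne_zero one_ne_zero
  simpa using h

theorem ld_pow (hT : MulPres T) (hu : ∀ x, Corr T x (u x)) (hus : ContDiff ℝ ∞ u) (hF : IsSm F x)
    (hF0 : F x ≠ 0) (k : ℕ) : ld T u e x (fun y => F y ^ k) = k * ld T u e x F := by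
  induction k with
  | zero => simpa using ld_one hT hu hus
  | succ k ih =>
    simp_rw [pow_succ]
    rw [ld_mul hT hu hus (hF.pow k) hF (pow_ne_zero k hF0) hF0, ih]
    push_cast; ring

/-- The logarithmic derivative is controlled by a `C^N` norm. -/
def LdBound (T : 𝓢(E, ℂ) ≃ 𝓢(E, ℂ)) (u : E → E) (e x : E) (N : ℕ) (K : ℝ) : Prop :=
  ∀ A, 1 ≤ A → ∀ g : 𝓢(E, ℂ), CB N A g → g x ≠ 0 → ‖ld T u e x g‖ ≤ K * A * (1 + ‖g x‖⁻¹)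

/-- Both `t g` and `t χ`, the latter with the germ of the constant `t`, are small in `C^N` for small
`t`. By additivity the logarithmic derivative of `g` is the difference of theirs. -/
theorem exists_ldBound (hT : MulPres T) (hu : ∀ x, Corr T x (u x)) (hus : ContDiff ℝ ∞ u)
    (hn : ∀ f x, ‖T f (u x)‖ = ‖f x‖) (he : ‖e‖ = 1) {z : E} {r : ℝ} (hr : 0 < r) {N : ℕ}
    {δ C : ℝ} (hδ : 0 < δ)
    (hC : ∀ x ∈ Metric.ball z r, ∀ g : 𝓢(E, ℂ), CB N δ g →
      ‖fderiv ℝ (fun y => T g (u y)) x‖ ≤ C) :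
    ∃ K, 0 ≤ K ∧ ∀ x ∈ Metric.ball z r, LdBound T u e x N K := by
  obtain ⟨χ, -, -, hχ⟩ := exists_ball_cutoff z hr (lt_two_mul_self hr)
  obtain ⟨M, hM1, hM⟩ := CB.of_schwartz N χ
  have hC0 : 0 ≤ C := (norm_nonneg _).trans (hC z (Metric.mem_ball_self hr) 0 (by
    intro l _ y
    change ‖iteratedFDeriv ℝ l (fun _ => (0 : ℂ)) y‖ ≤ δ
    rw [iteratedFDeriv_fun_zero]
    simpa using hδ.le))
  refine ⟨C * M / δ, by positivity, fun x hx A hA g hg hgx => ?_⟩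
  have hχx : ∀ᶠ y in 𝓝 x, χ y = 1 := by
    filter_upwards [Metric.isOpen_ball.mem_nhds hx] with y hy
    exact hχ y (Metric.ball_subset_closedBall hy)
  have key : ∀ g : 𝓢(E, ℂ), CB N δ g → g x ≠ 0 → ‖ld T u e x g‖ ≤ C / ‖g x‖ := fun g hg hgx => by
    rw [ld_eq hT hu (Eventually.of_forall fun _ => rfl), norm_div, hn]
    refine div_le_div_of_nonneg_right ?_ (norm_nonneg _)
    refine ((fderiv ℝ (fun z => T g (u z)) x).le_opNorm e).trans ?_
    rw [he, mul_one]
    exact hC x hx g hg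
  -- This `t` brings both `g`, of size `A`, and `χ`, of size `M`, below `δ`.
  set t : ℝ := δ / (A * M) with ht
  have ht0 : 0 < t := by positivity
  have ht0' : (t : ℂ) ≠ 0 := by exact_mod_cast ht0.ne'
  have htn : ‖(t : ℂ)‖ = t := by rw [Complex.norm_real, Real.norm_of_nonneg ht0.le]
  have h1 := key ((t : ℂ) • g) ((hg.const_mul (contDiff_coe g) t).mono (by
    rw [htn, ht, div_mul_eq_mul_div, div_le_iff₀ (by positivity)]
    nlinarith [mul_pos hδ (zero_lt_one.trans_le hA)])) (by simp [hgx, ht0.ne'])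
  have h2 := key ((t : ℂ) • χ) ((hM.const_mul (contDiff_coe χ) t).mono (by
    rw [htn, ht, div_mul_eq_mul_div, div_le_iff₀ (by positivity)]
    nlinarith [mul_pos hδ (zero_lt_one.trans_le hM1)])) (by simp [hχx.self_of_nhds, ht0.ne'])
  have h3 : ld T u e x ((t : ℂ) • g : 𝓢(E, ℂ)) = ld T u e x (fun _ => (t : ℂ)) + ld T u e x g := by
    rw [← ld_mul hT hu hus (isSm_const _) (isSm_schwartz g) ht0' hgx]
    rfl
  have h4 : ld T u e x ((t : ℂ) • χ : 𝓢(E, ℂ)) = ld T u e x (fun _ => (t : ℂ)) := by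
    refine ld_congr hT hu (isSm_const _) ?_
    filter_upwards [hχx] with y hy
    simp [hy]
  have h5 : ld T u e x g = ld T u e x ((t : ℂ) • g : 𝓢(E, ℂ)) -
      ld T u e x ((t : ℂ) • χ : 𝓢(E, ℂ)) := by rw [h3, h4]; ring
  rw [h5]
  refine (norm_sub_le _ _).trans ((add_le_add h1 h2).trans (le_of_eq ?_))
  have hgx' := norm_pos_iff.2 hgx
  simp only [smul_apply, smul_eq_mul, norm_mul, hχx.self_of_nhds, mul_one, htn]
  rw [ht]
  field_simp
  ring

variable {N : ℕ} {K : ℝ}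

theorem LdBound.of_eventually (hK : LdBound T u e x N K) (hT : MulPres T)
    (hu : ∀ x, Corr T x (u x)) {A : ℝ} (hA : 1 ≤ A) {g : 𝓢(E, ℂ)} (hg : CB N A g)
    (hF : ∀ᶠ y in 𝓝 x, g y = F y) (hF0 : F x ≠ 0) : ‖ld T u e x F‖ ≤ K * A * (1 + ‖F x‖⁻¹) := by
  have h := hK A hA g hg (by rwa [hF.self_of_nhds])
  rwa [hF.self_of_nhds, ← ld_congr hT hu (isSm_schwartz g) (hF.mono fun _ h => h.symm)] at h

/-- A logarithmic derivative of finite order ignores perturbations of high order. -/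
theorem LdBound.one_add_pow_eq_zero (hK : LdBound T u e x N K) (hT : MulPres T)
    (hu : ∀ x, Corr T x (u x)) (hus : ContDiff ℝ ∞ u) {h k : E → ℂ} (hh : IsSm h x)
    (hk : IsSm k x) (h0 : h x = 0) {m : ℕ} (hm : N < m) :
    ld T u e x (fun y => 1 + k y * h y ^ m) = 0 := by
  obtain ⟨χ, hχc, -, hχ⟩ := exists_cutoff (univ_mem : Set.univ ∈ 𝓝 x)
  obtain ⟨M, hM1, hM⟩ := CB.of_schwartz N χ
  obtain ⟨η, -, hη⟩ := ((contDiff_id (𝕜 := ℝ) (E := ℂ) (n := ∞)).pow m).isSm (0 : ℂ) |>.exists_eq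
  obtain ⟨B, hB1, hB⟩ := CB.of_schwartz N η
  obtain ⟨a, -, ha⟩ := hh.exists_eq
  obtain ⟨D, hD1, hD⟩ := CB.of_schwartz N a
  have hm0 : m ≠ 0 := by lia
  have hw : IsSm (fun y => 1 + k y * h y ^ m) x := (isSm_const 1).add (hk.mul (hh.pow m))
  have hw0 : 1 + k x * h x ^ m = 1 := by simp [h0, hm0]
  -- The `j`-th power of the germ is again of the form `1 + k' h ^ m`, and such a germ has a
  -- representative whose `C^N` norm is bounded independently of `k'`. So `j` times the logarithmic
  -- derivative stays bounded.
  have main : ∀ j : ℕ, ‖(j : ℂ) * ld T u e x (fun y => 1 + k y * h y ^ m)‖ ≤ K * (M + 1) * 2 := by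
    intro j
    rw [← ld_pow hT hu hus hw (by rw [hw0]; exact one_ne_zero)]
    let P : E → ℂ := fun y => ∑ i ∈ Finset.range j, (1 + k y * h y ^ m) ^ i
    have hP : IsSm P x := IsSm.sum _ fun i _ => hw.pow i
    have hPj : ∀ y, (1 + k y * h y ^ m) ^ j = 1 + (k y * P y) * h y ^ m := fun y => by
      have := mul_geom_sum (1 + k y * h y ^ m) j
      simp only [P]
      linear_combination -this
    obtain ⟨κ, hκc, hκ⟩ := (hk.mul hP).exists_eq
    obtain ⟨L, hL1, hL⟩ := CB.of_schwartz N κ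
    set Q := 2 ^ N * L * (N.factorial * B * D ^ N) with hQ
    have hQ0 : 0 < Q := by positivity
    -- With `η z = z ^ m` near zero, `t⁻ᵐ η (t h)` has the germ of `h ^ m`, and its product with `κ`
    -- has `C^N` norm at most `Q t ^ (N - m) ≤ Q / t ≤ 1`.
    set t : ℝ := max 1 Q with ht
    have ht1 : 1 ≤ t := le_max_left _ _
    have htQ : Q ≤ t := le_max_right _ _
    have ht0 : 0 < t := by linarith
    have hηs : ContDiff ℝ ∞ fun y => η ((t : ℂ) * a y) :=
      (contDiff_coe η).comp (contDiff_const.mul (contDiff_coe a))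
    have hps : ContDiff ℝ ∞ fun y => κ y * η ((t : ℂ) * a y) := (contDiff_coe κ).mul hηs
    have hqs : ContDiff ℝ ∞ fun y => ((t : ℂ) ^ m)⁻¹ * (κ y * η ((t : ℂ) * a y)) :=
      contDiff_const.mul hps
    have hqB : CB N 1 fun y => ((t : ℂ) ^ m)⁻¹ * (κ y * η ((t : ℂ) * a y)) := by
      refine ((hL.mul (contDiff_coe κ) hηs (CB.comp_mul (contDiff_coe η) (contDiff_coe a)
        hB hD hD1 ht1)).const_mul hps _).mono ?_
      rw [norm_inv, norm_pow, Complex.norm_real, Real.norm_of_nonneg ht0.le]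
      rw [inv_mul_le_iff₀ (by positivity), mul_one]
      calc 2 ^ N * L * (N.factorial * B * D ^ N * t ^ N) = Q * t ^ N := by rw [hQ]; ring
        _ ≤ t * t ^ N := by gcongr
        _ = t ^ (N + 1) := by ring
        _ ≤ t ^ m := pow_le_pow_right₀ ht1 hm
    have hgs : ContDiff ℝ ∞ fun y => χ y + ((t : ℂ) ^ m)⁻¹ * (κ y * η ((t : ℂ) * a y)) :=
      (contDiff_coe χ).add hqs
    have hgB := hM.add (contDiff_coe χ) hqs hqB
    have hgc : HasCompactSupport fun y =>
        χ y + ((t : ℂ) ^ m)⁻¹ * (κ y * η ((t : ℂ) * a y)) := hχc.add (hκc.mul_right).mul_left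
    let g : 𝓢(E, ℂ) := hgc.toSchwartzMap hgs
    have hgB' : CB N (M + 1) g := hgB
    have hta : Tendsto (fun y => (t : ℂ) * a y) (𝓝 x) (𝓝 0) := by
      have h1 : Continuous fun y => (t : ℂ) * a y := continuous_const.mul a.continuous
      have h2 := h1.tendsto x
      rwa [ha.self_of_nhds, h0, mul_zero] at h2
    have hgx : ∀ᶠ y in 𝓝 x, g y = (1 + k y * h y ^ m) ^ j := by
      filter_upwards [hχ, hκ, hta.eventually hη, ha] with y h1 h2 h3 h4
      have htm : (t : ℂ) ^ m ≠ 0 := pow_ne_zero _ (by exact_mod_cast ht0.ne')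
      change χ y + ((t : ℂ) ^ m)⁻¹ * (κ y * η ((t : ℂ) * a y)) = _
      rw [h1, h2, h3, h4, hPj]
      simp only [id]
      rw [mul_pow]
      field_simp
    have h5 := hK.of_eventually hT hu (by linarith) hgB' hgx (by rw [hw0]; simp)
    rw [hw0] at h5
    norm_num at h5
    linarith
  by_contra hne
  have hpos := norm_pos_iff.2 hne
  obtain ⟨j, hj⟩ := exists_nat_gt (K * (M + 1) * 2 / ‖ld T u e x fun y => 1 + k y * h y ^ m‖)
  have h1 := main j
  rw [norm_mul, Complex.norm_natCast] at h1
  rw [div_lt_iff₀ hpos] at hj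
  linarith

end Ld

end SchwartzMul

/-! ### The logarithmic derivative depends on the first jet only -/

namespace SchwartzMul

open Filter Topology

variable {E : Type} [NormedAddCommGroup E] [InnerProductSpace ℝ E] [FiniteDimensional ℝ E]
  {T : 𝓢(E, ℂ) ≃ 𝓢(E, ℂ)} {u : E → E} {e x : E} {F G : E → ℂ} {N : ℕ} {K : ℝ}

/-- The logarithmic derivative of `1 + c a` grows at most linearly in `c`. -/
theorem LdBound.exists_linear_bound (hK : LdBound T u e x N K) (hT : MulPres T)
    (hu : ∀ x, Corr T x (u x)) {a : E → ℂ} (ha : IsSm a x) (h0 : a x = 0) :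
    ∃ A, 0 ≤ A ∧ ∀ c : ℂ, ‖ld T u e x (fun y => 1 + c * a y)‖ ≤ A * max 1 ‖c‖ := by
  obtain ⟨χ, -, -, hχ⟩ := exists_cutoff (univ_mem : Set.univ ∈ 𝓝 x)
  obtain ⟨M, hM1, hM⟩ := CB.of_schwartz N χ
  obtain ⟨b, -, hb⟩ := ha.exists_eq
  obtain ⟨D, hD1, hD⟩ := CB.of_schwartz N b
  have key : ∀ c : ℂ,
      ‖ld T u e x (fun y => 1 + c * a y)‖ ≤ K * (M + D) * 2 * max 1 ‖c‖ := fun c => by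
    have hg : CB N ((M + D) * max 1 ‖c‖) (χ + c • b : 𝓢(E, ℂ)) := by
      refine (hM.add (contDiff_coe χ) (contDiff_const.mul (contDiff_coe b))
        (hD.const_mul (contDiff_coe b) c)).mono ?_
      rw [add_mul]
      refine add_le_add (le_mul_of_one_le_right (by linarith) (le_max_left _ _)) ?_
      rw [mul_comm]
      exact mul_le_mul_of_nonneg_left (le_max_right _ _) (by linarith)
    have h1 := hK.of_eventually hT hu (A := (M + D) * max 1 ‖c‖)
      (F := fun y => 1 + c * a y) (by nlinarith [le_max_left 1 ‖c‖]) hg (by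
        filter_upwards [hχ, hb] with y h1 h2
        simp [h1, h2]) (by simp [h0])
    refine h1.trans (le_of_eq ?_)
    simp [h0]
    ring
  refine ⟨K * (M + D) * 2, ?_, key⟩
  have := (norm_nonneg _).trans (key 0)
  simpa using this

/-- If fourth order perturbations `1 + k a⁴` are ignored, so is `1 + a²`. -/
theorem LdBound.one_add_sq_eq_zero (hK : LdBound T u e x N K) (hT : MulPres T)
    (hu : ∀ x, Corr T x (u x)) (hus : ContDiff ℝ ∞ u) {a : E → ℂ} (ha : IsSm a x) (h0 : a x = 0)
    (h4 : ∀ k : E → ℂ, IsSm k x → ld T u e x (fun y => 1 + k y * a y ^ 4) = 0) :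
    ld T u e x (fun y => 1 + a y ^ 2) = 0 := by
  have hsm : ∀ c : ℂ, IsSm (fun y => 1 + c * a y ^ 2) x := fun c =>
    (isSm_const 1).add ((isSm_const c).mul (ha.pow 2))
  have hsm1 : ∀ c : ℂ, IsSm (fun y => 1 + c * a y) x := fun c =>
    (isSm_const 1).add ((isSm_const c).mul ha)
  have hv : ∀ c : ℂ, 1 + c * a x ^ 2 ≠ 0 := fun c => by simp [h0]
  have hv1 : ∀ c : ℂ, 1 + c * a x ≠ 0 := fun c => by simp [h0]
  let L : ℝ → ℂ := fun c => ld T u e x (fun y => 1 + (c : ℂ) * a y ^ 2)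
  -- The product `(1 + s a²)(1 + t a²)` differs from `1 + (s + t) a²` by a factor `1 + k a⁴`, which
  -- is ignored.
  have hadd : ∀ s t, L (s + t) = L s + L t := fun s t => by
    have hk : IsSm (fun y => (s : ℂ) * t * (1 + ((s + t : ℝ) : ℂ) * a y ^ 2)⁻¹) x :=
      (isSm_const _).mul ((hsm _).inv (hv _))
    simp only [L]
    rw [← ld_mul hT hu hus (hsm _) (hsm _) (hv _) (hv _), ← add_zero (ld T u e x _), ← h4 _ hk,
      ← ld_mul hT hu hus (hsm _) ((isSm_const 1).add (hk.mul (ha.pow 4))) (hv _) (by simp [h0])]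
    refine ld_congr hT hu ((hsm _).mul (hsm _)) ?_
    filter_upwards [(hsm ((s + t : ℝ) : ℂ)).contDiffAt.continuousAt.eventually_ne (hv _)] with y hy
    field_simp
    push_cast
    ring
  obtain ⟨A, hA0, hA⟩ := hK.exists_linear_bound hT hu (ha.pow 2) (by simp [h0])
  obtain ⟨B, hB0, hB⟩ := hK.exists_linear_bound hT hu ha h0
  have hlin := map_smul_of_bounded L hadd (C := A) (fun c hc => by
    have := hA c
    rwa [Complex.norm_real, max_eq_left hc, mul_one] at this)
  -- Since `1 - s² a² = (1 + s a)(1 - s a)`, the number `s² |L 1|` is at most linear in `s`.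
  have hquad : ∀ s : ℝ, 1 ≤ s → s * ‖L 1‖ ≤ 2 * B := fun s hs => by
    have h1 : L (-s ^ 2) = ld T u e x (fun y => 1 + (s : ℂ) * a y) +
        ld T u e x (fun y => 1 + (-s : ℂ) * a y) := by
      rw [← ld_mul hT hu hus (hsm1 _) (hsm1 _) (hv1 _) (hv1 _)]
      simp only [L]
      congr 1
      funext y
      push_cast
      ring
    have h2 := hlin (-s ^ 2) 1
    rw [smul_eq_mul, mul_one, h1] at h2
    have h3 := norm_add_le_of_le (hB (s : ℂ)) (hB (-s : ℂ))
    rw [h2, norm_neg, Complex.norm_real, Real.norm_of_nonneg (by linarith), max_eq_right hs,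
      norm_smul, norm_neg, norm_pow, Real.norm_of_nonneg (by linarith)] at h3
    nlinarith [norm_nonneg (L 1)]
  have h5 : L 1 = 0 := by
    by_contra hne
    have hpos := norm_pos_iff.2 hne
    have h6 := hquad (max 1 ((2 * B + 1) / ‖L 1‖)) (le_max_left _ _)
    have h7 : (2 * B + 1) / ‖L 1‖ * ‖L 1‖ ≤ 2 * B :=
      (mul_le_mul_of_nonneg_right (le_max_right _ _) hpos.le).trans h6
    rw [div_mul_cancel₀ _ hpos.ne'] at h7
    linarith
  simpa [L] using h5

/-- The logarithmic derivative ignores second order perturbations. -/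
theorem LdBound.one_add_mul_sq_eq_zero (hK : LdBound T u e x N K) (hT : MulPres T)
    (hu : ∀ x, Corr T x (u x)) (hus : ContDiff ℝ ∞ u) {k h : E → ℂ} (hk : IsSm k x)
    (hh : IsSm h x) (h0 : h x = 0) : ld T u e x (fun y => 1 + k y * h y ^ 2) = 0 := by
  -- Descending induction on the order `2 ^ (i + 1)`: once `i > N` it exceeds `N`, and each step
  -- halves it.
  suffices H : ∀ d i : ℕ, N + 1 ≤ i + d → ∀ k h : E → ℂ, IsSm k x → IsSm h x → h x = 0 →
      ld T u e x (fun y => 1 + k y * h y ^ (2 ^ (i + 1))) = 0 by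
    simpa using H (N + 1) 0 (by lia) k h hk hh h0
  intro d
  induction d with
  | zero =>
    intro i hi k h hk hh h0
    refine hK.one_add_pow_eq_zero hT hu hus hh hk h0 ?_
    have : i + 1 < 2 ^ (i + 1) := Nat.lt_two_pow_self
    lia
  | succ d ih =>
    intro i hi k h hk hh h0
    have ih' := ih (i + 1) (by lia)
    set m := 2 ^ i with hm
    have hm0 : m ≠ 0 := by positivity
    have e1 : 2 ^ (i + 1) = m * 2 := by rw [pow_succ]
    have e2 : 2 ^ (i + 1 + 1) = m * 4 := by rw [pow_succ, pow_succ]; ring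
    rw [e2] at ih'
    rw [e1]
    have hsq : ∀ a : E → ℂ, IsSm a x →
        ld T u e x (fun y => 1 + (a y * h y ^ m) ^ 2) = 0 := fun a ha => by
      refine hK.one_add_sq_eq_zero hT hu hus (ha.mul (hh.pow m)) (by simp [h0, hm0])
        fun k' hk' => ?_
      rw [← ih' (fun y => k' y * a y ^ 4) h (hk'.mul (ha.pow 4)) hh h0]
      congr 1
      funext y
      ring
    -- Here `A² + B² = k`, so `1 + k h^(2m)` is the product of `1 + (A h^m)²` and `1 + (B h^m)²` up
    -- to the factor `1 + C h^(4m)` built in `hC`, which the induction hypothesis ignores.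
    let A : E → ℂ := fun y => (k y + 1) * (1 / 2)
    let B : E → ℂ := fun y => Complex.I * ((k y - 1) * (1 / 2))
    have hA : IsSm A x := (hk.add (isSm_const 1)).mul (isSm_const _)
    have hB : IsSm B x := (isSm_const _).mul ((hk.sub (isSm_const 1)).mul (isSm_const _))
    have hA1 : IsSm (fun y => 1 + (A y * h y ^ m) ^ 2) x :=
      (isSm_const 1).add ((hA.mul (hh.pow m)).pow 2)
    have hB1 : IsSm (fun y => 1 + (B y * h y ^ m) ^ 2) x :=
      (isSm_const 1).add ((hB.mul (hh.pow m)).pow 2)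
    have hAB := hA1.mul hB1
    have hA0 : 1 + (A x * h x ^ m) ^ 2 ≠ 0 := by simp [h0, hm0]
    have hB0 : 1 + (B x * h x ^ m) ^ 2 ≠ 0 := by simp [h0, hm0]
    have hAB0 := mul_ne_zero hA0 hB0
    have hC : IsSm (fun y => -(1 : ℂ) * (A y ^ 2 * B y ^ 2 *
        ((1 + (A y * h y ^ m) ^ 2) * (1 + (B y * h y ^ m) ^ 2))⁻¹)) x :=
      (isSm_const _).mul (((hA.pow 2).mul (hB.pow 2)).mul (hAB.inv hAB0))
    have h1 := ld_mul (e := e) hT hu hus hA1 hB1 hA0 hB0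
    rw [hsq A hA, hsq B hB, add_zero] at h1
    have hC1 := (isSm_const (x := x) (1 : ℂ)).add (hC.mul (hh.pow (m * 4)))
    have hC0 : 1 + -(1 : ℂ) * (A x ^ 2 * B x ^ 2 *
        ((1 + (A x * h x ^ m) ^ 2) * (1 + (B x * h x ^ m) ^ 2))⁻¹) * h x ^ (m * 4) ≠ 0 := by
      simp [h0, hm0]
    have h2 := ld_mul (e := e) hT hu hus hAB hC1 hAB0 hC0
    rw [h1, ih' _ h hC hh h0, add_zero] at h2
    rw [← h2]
    refine ld_congr hT hu (hAB.mul hC1) ?_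
    filter_upwards [hAB.contDiffAt.continuousAt.eventually_ne hAB0] with y hy
    have hI : B y ^ 2 = -((k y - 1) * (1 / 2)) ^ 2 := by
      simp only [B]
      rw [mul_pow, Complex.I_sq]; ring
    have h3 : ((1 + (A y * h y ^ m) ^ 2) * (1 + (B y * h y ^ m) ^ 2)) *
        (1 + -(1 : ℂ) * (A y ^ 2 * B y ^ 2 *
          ((1 + (A y * h y ^ m) ^ 2) * (1 + (B y * h y ^ m) ^ 2))⁻¹) * h y ^ (m * 4)) =
        1 + (A y ^ 2 + B y ^ 2) * h y ^ (m * 2) := by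
      rw [mul_add, mul_one]
      have : ∀ P Q R : ℂ, P ≠ 0 → P * (-1 * (Q * P⁻¹) * R) = -Q * R := fun P Q R hP => by
        field_simp
      rw [this _ _ _ hy]
      ring
    rw [h3, hI]
    simp only [A]
    ring

/-- Polarization: `k h = A² - B²` with `A` and `B` vanishing at `x`, and `1 + A² - B²` factors as `1
+ A²` times `1 - B² / (1 + A²)`. -/
theorem LdBound.one_add_mul_eq_zero (hK : LdBound T u e x N K) (hT : MulPres T)
    (hu : ∀ x, Corr T x (u x)) (hus : ContDiff ℝ ∞ u) {k h : E → ℂ} (hk : IsSm k x)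
    (hh : IsSm h x) (k0 : k x = 0) (h0 : h x = 0) :
    ld T u e x (fun y => 1 + k y * h y) = 0 := by
  let A : E → ℂ := fun y => (k y + h y) * (1 / 2)
  let B : E → ℂ := fun y => (k y - h y) * (1 / 2)
  have hA : IsSm A x := (hk.add hh).mul (isSm_const _)
  have hB : IsSm B x := (hk.sub hh).mul (isSm_const _)
  have hA0 : A x = 0 := by simp [A, k0, h0]
  have hB0 : B x = 0 := by simp [B, k0, h0]
  have hA1 : IsSm (fun y => 1 + 1 * A y ^ 2) x :=
    (isSm_const 1).add ((isSm_const 1).mul (hA.pow 2))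
  have hA10 : 1 + 1 * A x ^ 2 ≠ 0 := by simp [hA0]
  have hC : IsSm (fun y => (-1 : ℂ) * (1 + 1 * A y ^ 2)⁻¹) x :=
    (isSm_const _).mul (hA1.inv hA10)
  have hC1 := (isSm_const (x := x) (1 : ℂ)).add (hC.mul (hB.pow 2))
  have h2 := ld_mul (e := e) hT hu hus hA1 hC1 hA10 (by simp [hB0])
  rw [hK.one_add_mul_sq_eq_zero hT hu hus (isSm_const 1) hA hA0,
    hK.one_add_mul_sq_eq_zero hT hu hus hC hB hB0, add_zero] at h2
  rw [← h2]
  refine ld_congr hT hu (hA1.mul hC1) ?_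
  filter_upwards [hA1.contDiffAt.continuousAt.eventually_ne hA10] with y hy
  have : ∀ P Q : ℂ, P ≠ 0 → P * (1 + -1 * P⁻¹ * Q) = P - Q := fun P Q hP => by
    field_simp
    ring
  rw [this _ _ hy]
  simp only [A, B]
  ring

theorem LdBound.one_add_sum_eq_zero (hK : LdBound T u e x N K) (hT : MulPres T)
    (hu : ∀ x, Corr T x (u x)) (hus : ContDiff ℝ ∞ u) {ι : Type*} (s : Finset ι)
    {k h : ι → E → ℂ} (hk : ∀ i, IsSm (k i) x)
    (hh : ∀ i, IsSm (h i) x) (k0 : ∀ i, k i x = 0) (h0 : ∀ i, h i x = 0) :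
    ld T u e x (fun y => 1 + ∑ i ∈ s, k i y * h i y) = 0 := by
  classical
  induction s using Finset.induction_on with
  | empty => simpa using ld_one hT hu hus
  | insert i s hi ih =>
    have hS : IsSm (fun y => 1 + ∑ i ∈ s, k i y * h i y) x :=
      (isSm_const 1).add (IsSm.sum _ fun i _ => (hk i).mul (hh i))
    have hS0 : 1 + ∑ i ∈ s, k i x * h i x ≠ 0 := by simp [k0]
    have hk' := (hk i).mul (hS.inv hS0)
    have h1 := hK.one_add_mul_eq_zero hT hu hus hk' (hh i) (by simp [k0]) (h0 i)
    have h2 := ld_mul (e := e) hT hu hus hS ((isSm_const 1).add (hk'.mul (hh i))) hS0 (by simp [k0])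
    rw [ih, h1, add_zero] at h2
    rw [← h2]
    refine ld_congr hT hu (hS.mul ((isSm_const 1).add (hk'.mul (hh i)))) ?_
    filter_upwards [hS.contDiffAt.continuousAt.eventually_ne hS0] with y hy
    rw [Finset.sum_insert hi]
    field_simp
    ring

/-- The logarithmic derivative only depends on the first order Taylor polynomial. -/
theorem LdBound.eq_taylor (hK : LdBound T u e x N K) (hT : MulPres T)
    (hu : ∀ x, Corr T x (u x)) (hus : ContDiff ℝ ∞ u) (hF : ContDiff ℝ ∞ F) (hF0 : F x ≠ 0) :
    ld T u e x F = ld T u e x (fun y => F x + fderiv ℝ F x (y - x)) := by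
  -- With `L` the affine Taylor polynomial, `F = L (1 + ∑ τ i · k i / L)`, where all `τ i` and `k i`
  -- vanish at `x`.
  obtain ⟨k, hk, k0, hFk⟩ := exists_taylor_two x hF
  have hL : IsSm (fun y => F x + fderiv ℝ F x (y - x)) x := by
    apply ContDiff.isSm
    fun_prop
  have hL0 : F x + fderiv ℝ F x (x - x) ≠ 0 := by simpa using hF0
  have hτ : ∀ i, IsSm (fun y => ((inner ℝ (stdOrthonormalBasis ℝ E i) (y - x) : ℝ) : ℂ)) x :=
    fun i => by
      apply ContDiff.isSm
      have h1 : ContDiff ℝ ∞ fun y : E => (inner ℝ (stdOrthonormalBasis ℝ E i) (y - x) : ℝ) :=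
        contDiff_const.inner ℝ (contDiff_id.sub contDiff_const)
      exact Complex.ofRealCLM.contDiff.comp h1
  have hk' := fun i => ((hk i).isSm x).mul (hL.inv hL0)
  have h1 := hK.one_add_sum_eq_zero hT hu hus Finset.univ hτ hk' (fun i => by simp)
    (fun i => by simp [k0])
  have hS := (isSm_const (x := x) (1 : ℂ)).add
    (IsSm.sum Finset.univ fun i _ => (hτ i).mul (hk' i))
  have h2 := ld_mul (e := e) hT hu hus hL hS hL0 (by simp)
  rw [h1, add_zero] at h2
  rw [← h2]
  refine ld_congr hT hu (hL.mul hS) ?_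
  filter_upwards [hL.contDiffAt.continuousAt.eventually_ne hL0] with y hy
  rw [hFk y, mul_add, mul_one, Finset.mul_sum]
  congr 1
  refine Finset.sum_congr rfl fun i _ => ?_
  field_simp

end SchwartzMul

/-! ### Germs of value one have images of value one -/

namespace SchwartzMul

open Filter Topology

variable {E : Type} [NormedAddCommGroup E] [InnerProductSpace ℝ E] [FiniteDimensional ℝ E]

/-- The point is that `A` does not depend on `x`, `a` or `l`: cut-off affine functions are
combinations, with bounded coefficients, of finitely many fixed functions. -/
theorem exists_affine_bound (z : E) {r : ℝ} (hr : 0 < r) (N : ℕ) {C : ℝ} (hC : 0 ≤ C) :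
    ∃ A, 1 ≤ A ∧ ∀ x ∈ Metric.ball z r, ∀ (a : ℂ) (l : E →L[ℝ] ℂ), ‖a‖ ≤ 2 → ‖l‖ ≤ C →
      ∃ g : 𝓢(E, ℂ), CB N A g ∧ ∀ y ∈ Metric.ball z r, g y = a + l (y - x) := by
  obtain ⟨χ, hχc, -, hχ⟩ := exists_ball_cutoff z hr (lt_two_mul_self hr)
  obtain ⟨M, hM1, hM⟩ := CB.of_schwartz N χ
  let b := stdOrthonormalBasis ℝ E
  let τ : Fin (Module.finrank ℝ E) → E → ℂ := fun i y => χ y * ((inner ℝ (b i) y : ℝ) : ℂ)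
  have hτs : ∀ i, ContDiff ℝ ∞ (τ i) := fun i => by
    have h1 : ContDiff ℝ ∞ fun y : E => (inner ℝ (b i) y : ℝ) := contDiff_const.inner ℝ contDiff_id
    exact (contDiff_coe χ).mul (Complex.ofRealCLM.contDiff.comp h1)
  have hτc : ∀ i, HasCompactSupport (τ i) := fun i => hχc.mul_right
  choose D hD1 hD using fun i => CB.of_schwartz N ((hτc i).toSchwartzMap (hτs i))
  have hS : 0 ≤ ∑ i, C * D i := Finset.sum_nonneg fun i _ => mul_nonneg hC (by linarith [hD1 i])
  refine ⟨(2 + C * (‖z‖ + r)) * M + ∑ i, C * D i, ?_, fun x hx a l ha hl => ?_⟩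
  · nlinarith [mul_nonneg hC (add_nonneg (norm_nonneg z) hr.le)]
  have hc : HasCompactSupport fun y => χ y * (a + l (y - x)) := hχc.mul_right
  have hs : ContDiff ℝ ∞ fun y => χ y * (a + l (y - x)) :=
    (contDiff_coe χ).mul (by fun_prop)
  refine ⟨hc.toSchwartzMap hs, ?_, fun y hy => ?_⟩
  · have heq : (hc.toSchwartzMap hs : E → ℂ) =
        fun y => (a - l x) * χ y + ∑ i, l (b i) * τ i y := by
      funext y
      change χ y * (a + l (y - x)) = _
      have h1 : l y = ∑ i, ((inner ℝ (b i) y : ℝ) : ℂ) * l (b i) := by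
        conv_lhs => rw [← b.sum_repr' y]
        rw [map_sum]
        refine Finset.sum_congr rfl fun i _ => ?_
        rw [map_smul, Complex.real_smul]
      have h2 : ∑ i, l (b i) * τ i y = χ y * ∑ i, ((inner ℝ (b i) y : ℝ) : ℂ) * l (b i) := by
        rw [Finset.mul_sum]
        refine Finset.sum_congr rfl fun i _ => ?_
        simp only [τ]; ring
      rw [h2, map_sub, h1]
      ring
    rw [heq]
    refine CB.mono ((hM.const_mul (contDiff_coe χ) _).add (contDiff_const.mul (contDiff_coe χ))
      (ContDiff.sum fun i _ => contDiff_const.mul (hτs i))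
      (CB.sum _ (fun i => contDiff_const.mul (hτs i))
        fun i => (hD i).const_mul (hτs i) (l (b i)))) ?_
    refine add_le_add (mul_le_mul_of_nonneg_right ?_ (by linarith))
      (Finset.sum_le_sum fun i _ => mul_le_mul_of_nonneg_right ?_ (by linarith [hD1 i]))
    · have hx' : ‖x‖ ≤ ‖z‖ + r := by
        have := norm_le_norm_add_norm_sub' x z
        rw [← dist_eq_norm] at this
        linarith [Metric.mem_ball.1 hx]
      exact (norm_sub_le _ _).trans (add_le_add ha ((l.le_opNorm x).trans
        (mul_le_mul hl hx' (norm_nonneg _) hC)))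
    · have := l.le_opNorm (b i)
      rw [b.norm_eq_one, mul_one] at this
      exact this.trans hl
  · change χ y * (a + l (y - x)) = _
    rw [hχ y (Metric.ball_subset_closedBall hy), one_mul]

/-- Cutting off a function that vanishes at `x` at a small scale gives a small function with
bounded gradient. -/
theorem exists_small_cutoff (f : 𝓢(E, ℂ)) {x : E} (hf : f x = 1) :
    ∃ D : ℝ, 0 ≤ D ∧ ∀ m : ℝ, 1 ≤ m → ∃ w : E → ℂ, ContDiff ℝ ∞ w ∧
      (∀ y, ‖w y‖ ≤ D / m) ∧ (∀ y, ‖fderiv ℝ w y‖ ≤ D) ∧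
      (∀ᶠ y in 𝓝 x, w y = f y - 1) ∧ ∀ y, 2 / m < ‖y - x‖ → w y = 0 := by
  obtain ⟨η, -, hηs, hη⟩ := exists_ball_cutoff (0 : E) one_pos (one_lt_two)
  obtain ⟨B, hB1, hB⟩ := CB.of_schwartz 1 η
  obtain ⟨D, hD1, hD⟩ := CB.of_schwartz 1 f
  have hηd : ∀ y, ‖fderiv ℝ η y‖ ≤ B := fun y => by
    rw [← norm_iteratedFDeriv_one]; exact hB 1 le_rfl y
  have hfd : ∀ y, ‖fderiv ℝ f y‖ ≤ D := fun y => by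
    rw [← norm_iteratedFDeriv_one]; exact hD 1 le_rfl y
  have hflip : ∀ y, ‖f y - 1‖ ≤ D * ‖y - x‖ := fun y => by
    rw [← hf]
    exact convex_univ.norm_image_sub_le_of_norm_fderiv_le (fun y _ => f.differentiableAt)
      (fun y _ => hfd y) (Set.mem_univ x) (Set.mem_univ y)
  -- The gradient has a part `B D` from that of `f`, and a part `(m B)(2 D / m)` from the cutoff,
  -- since `f - 1` is at most `2 D / m` within distance `2 / m`.
  refine ⟨3 * (B * D), by positivity, fun m hm => ?_⟩
  have hm0 : 0 < m := by linarith
  have hout : ∀ y, 2 / m < ‖y - x‖ → m • (y - x) ∉ tsupport η := fun y hy h => by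
    have h1 := hηs h
    rw [mem_closedBall_zero_iff, norm_smul, Real.norm_of_nonneg hm0.le] at h1
    rw [div_lt_iff₀ hm0] at hy
    linarith
  have hin : ∀ y, ‖y - x‖ ≤ 2 / m → ‖f y - 1‖ ≤ 2 * D / m := fun y hy => by
    refine (hflip y).trans ?_
    calc D * ‖y - x‖ ≤ D * (2 / m) := by gcongr
      _ = 2 * D / m := by ring
  have hs1 : ContDiff ℝ ∞ fun y => η (m • (y - x)) := (contDiff_coe η).comp (by fun_prop)
  have hs2 : ContDiff ℝ ∞ fun y => f y - 1 := (contDiff_coe f).sub contDiff_const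
  refine ⟨fun y => η (m • (y - x)) * (f y - 1), hs1.mul hs2, fun y => ?_, fun y => ?_, ?_,
    fun y hy => ?_⟩
  · change ‖η (m • (y - x)) * (f y - 1)‖ ≤ _
    rcases le_or_gt ‖y - x‖ (2 / m) with h | h
    · rw [norm_mul]
      calc _ ≤ B * (2 * D / m) := mul_le_mul (hB.norm_le _) (hin y h) (norm_nonneg _) (by linarith)
        _ = 2 * (B * D) / m := by ring
        _ ≤ 3 * (B * D) / m := by gcongr; norm_num
    · rw [image_eq_zero_of_notMem_tsupport (hout y h), zero_mul, norm_zero]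
      positivity
  · have hd1 : HasFDerivAt (fun y => η (m • (y - x)))
        ((fderiv ℝ η (m • (y - x))).comp (m • ContinuousLinearMap.id ℝ E)) y :=
      (η.differentiableAt.hasFDerivAt).comp y
        (((hasFDerivAt_id y).sub_const x).const_smul m)
    have hd2 : HasFDerivAt (fun y => f y - 1) (fderiv ℝ f y) y :=
      f.differentiableAt.hasFDerivAt.sub_const 1
    rw [(hd1.fun_mul hd2).fderiv]
    have hb1 : ‖η (m • (y - x)) • fderiv ℝ f y‖ ≤ B * D := by
      rw [norm_smul]
      exact mul_le_mul (hB.norm_le _) (hfd y) (norm_nonneg _) (by linarith)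
    have hb2 : ‖(f y - 1) • (fderiv ℝ η (m • (y - x))).comp
        (m • ContinuousLinearMap.id ℝ E)‖ ≤ 2 * (B * D) := by
      rcases le_or_gt ‖y - x‖ (2 / m) with h | h
      · rw [norm_smul, ContinuousLinearMap.comp_smul, ContinuousLinearMap.comp_id, norm_smul,
          Real.norm_of_nonneg hm0.le]
        calc _ ≤ (2 * D / m) * (m * B) := by
              refine mul_le_mul (hin y h) ?_ (by positivity) (by positivity)
              gcongr
              exact hηd _
          _ = 2 * (B * D) := by field_simp
      · rw [norm_smul, fderiv_of_notMem_tsupport ℝ (hout y h), ContinuousLinearMap.zero_comp,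
          norm_zero, mul_zero]
        positivity
    calc _ ≤ B * D + 2 * (B * D) := norm_add_le_of_le hb1 hb2
      _ = 3 * (B * D) := by ring
  · have hc : Continuous fun y => m • (y - x) := by fun_prop
    have h1 : ∀ᶠ y in 𝓝 x, m • (y - x) ∈ Metric.closedBall (0 : E) 1 := by
      refine hc.continuousAt.eventually_mem ?_
      rw [sub_self, smul_zero]
      exact Metric.closedBall_mem_nhds (0 : E) one_pos
    filter_upwards [h1] with y hy
    rw [hη _ hy, one_mul]
  · simp only
    rw [image_eq_zero_of_notMem_tsupport (hout y hy), zero_mul]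

variable {T : 𝓢(E, ℂ) ≃ 𝓢(E, ℂ)} {u : E → E}

/-- The image of a germ with value one has value one. -/
theorem ev_eq_one_of_ldBound (hT : MulPres T) (hu : ∀ x, Corr T x (u x)) (hus : ContDiff ℝ ∞ u)
    (hn : ∀ f x, ‖T f (u x)‖ = ‖f x‖) {e : E} (he : ‖e‖ = 1) {z : E} {r : ℝ} (hr : 0 < r) {N : ℕ}
    {K : ℝ} (hK0 : 0 ≤ K) (hK : ∀ x ∈ Metric.ball z r, LdBound T u e x N K) {x : E}
    (hx : x ∈ Metric.ball z r) {F : E → ℂ} (hF : IsSm F x) (hF1 : F x = 1) : ev T u x F = 1 := by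
  set f := rep x F with hf
  have hfx : f x = 1 := by rw [hf, hF.rep_eq.self_of_nhds, hF1]
  obtain ⟨D, hD0, hD⟩ := exists_small_cutoff f hfx
  obtain ⟨A, hA1, hA⟩ := exists_affine_bound z hr N hD0
  obtain ⟨χ, hχc, -, hχ⟩ := exists_ball_cutoff z hr (lt_two_mul_self hr)
  obtain ⟨ρ, hρ, hρz⟩ := Metric.isOpen_iff.1 Metric.isOpen_ball x hx
  -- The `3` bounds `1 + ‖1 + w y‖⁻¹` and the `2` bounds `‖1 + w y‖`.
  set C := K * A * 3 * 2 with hC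
  have hC0 : 0 ≤ C := by positivity
  have main : ∀ m : ℝ, 1 ≤ m → 2 * D ≤ m → 3 / ρ < m → ‖ev T u x F - 1‖ ≤ C * (3 / m) := by
    intro m hm1 hmD hmρ
    have hm0 : 0 < m := by linarith
    obtain ⟨w, hws, hwn, hwd, hwx, hw0⟩ := hD m hm1
    have hwn' : ∀ y, ‖w y‖ ≤ 1 / 2 := fun y => (hwn y).trans (by
      rw [div_le_div_iff₀ hm0 two_pos]; linarith)
    have h1w : ∀ y, 1 / 2 ≤ ‖1 + w y‖ := fun y => by
      have := norm_sub_le (1 + w y) (w y)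
      rw [add_sub_cancel_right, norm_one] at this
      linarith [hwn' y]
    have h1w0 : ∀ y, 1 + w y ≠ 0 := fun y h => by
      have := h1w y
      rw [h, norm_zero] at this
      linarith
    have h1w2 : ∀ y, ‖1 + w y‖ ≤ 2 := fun y => by
      have := norm_add_le 1 (w y)
      rw [norm_one] at this
      linarith [hwn' y]
    have hgc : HasCompactSupport fun y => χ y * (1 + w y) := hχc.mul_right
    have h1ws : ContDiff ℝ ∞ fun y => 1 + w y := contDiff_const.add hws
    let G : 𝓢(E, ℂ) := hgc.toSchwartzMap ((contDiff_coe χ).mul h1ws)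
    have hG : ∀ y ∈ Metric.ball z r, G y = 1 + w y := fun y hy => by
      change χ y * (1 + w y) = _
      rw [hχ y (Metric.ball_subset_closedBall hy), one_mul]
    have hGev : ∀ y ∈ Metric.ball z r, ∀ᶠ y' in 𝓝 y, G y' = 1 + w y' := fun y hy =>
      mem_of_superset (Metric.isOpen_ball.mem_nhds hy) hG
    -- No `C^N` bound on `w` uniform in `m` is needed: only the first jet of `1 + w` matters, and
    -- its uniform bound makes `C` independent of `m`.
    have hder : ∀ y ∈ Metric.ball z r, ‖fderiv ℝ (fun y => T G (u y)) y e‖ ≤ C := fun y hy => by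
      obtain ⟨g, hgA, hg⟩ := hA y hy (1 + w y) (fderiv ℝ w y) (h1w2 y) (hwd y)
      have h1 := ld_eq (e := e) hT hu (hGev y hy)
      have h2 : ‖T G (u y)‖ = ‖1 + w y‖ := by rw [hn, hG y hy]
      have h3 : T G (u y) ≠ 0 := fun h => by
        rw [h, norm_zero] at h2
        linarith [h1w y]
      rw [(hK y hy).eq_taylor hT hu hus h1ws (h1w0 y), fderiv_const_add] at h1
      have h4 := (hK y hy).of_eventually hT hu (F := fun y' => 1 + w y + fderiv ℝ w y (y' - y))
        hA1 hgA (mem_of_superset (Metric.isOpen_ball.mem_nhds hy) hg) (by simpa using h1w0 y)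
      have h5 : fderiv ℝ (fun y => T G (u y)) y e = ld T u e y
          (fun y' => 1 + w y + fderiv ℝ w y (y' - y)) * T G (u y) := by
        rw [h1, div_mul_cancel₀ _ h3]
      rw [h5, norm_mul, h2]
      have h6 : ‖1 + w y + fderiv ℝ w y (y - y)‖⁻¹ ≤ 2 := by
        rw [sub_self, map_zero, add_zero]
        exact inv_le_of_inv_le₀ two_pos (by linarith [h1w y])
      rw [hC]
      refine mul_le_mul (h4.trans ?_) (h1w2 y) (norm_nonneg _) (by positivity)
      refine mul_le_mul_of_nonneg_left (by linarith) (by positivity)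
    have hseg : ∀ t ∈ Set.Icc (0 : ℝ) (3 / m), x + t • e ∈ Metric.ball z r := fun t ht => by
      apply hρz
      rw [mem_ball_iff_norm, add_sub_cancel_left, norm_smul, he, mul_one, Real.norm_of_nonneg ht.1]
      refine ht.2.trans_lt ?_
      rw [div_lt_iff₀ hρ] at hmρ
      rw [div_lt_iff₀ hm0]
      linarith
    have hm3 : (0 : ℝ) ≤ 3 / m := by positivity
    have h7 := norm_image_sub_le_of_norm_deriv_le_segment'
      (f := fun t : ℝ => T G (u (x + t • e))) (a := 0) (b := 3 / m) (C := C)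
      (f' := fun t => fderiv ℝ (fun y => T G (u y)) (x + t • e) e)
      (fun t ht => by
        have h2 : HasDerivAt (fun t : ℝ => x + t • e) e t := by
          simpa using ((hasDerivAt_id t).smul_const e).const_add x
        exact (((contDiff_comp_map hus G).differentiable (by simp) _).hasFDerivAt.comp_hasDerivAt
          t h2).hasDerivWithinAt)
      (fun t ht => hder _ (hseg t ⟨ht.1, ht.2.le⟩)) (3 / m) ⟨hm3, le_rfl⟩
    -- At distance `3 / m` the perturbation `w`, which vanishes beyond `2 / m`, is gone and `G` has
    -- the germ of `1`.
    have h8 : T G (u (x + (3 / m) • e)) = 1 := by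
      refine ((hu _).eventually_one hT ?_).self_of_nhds
      have hc : Continuous fun y => ‖y - x‖ := by fun_prop
      have h9 : ∀ᶠ y in 𝓝 (x + (3 / m) • e), 2 / m < ‖y - x‖ := by
        refine hc.continuousAt.eventually_const_lt ?_
        change 2 / m < ‖x + (3 / m) • e - x‖
        rw [add_sub_cancel_left, norm_smul, he, mul_one, Real.norm_of_nonneg hm3]
        gcongr
        norm_num
      filter_upwards [hGev _ (hseg _ ⟨hm3, le_rfl⟩), h9] with y h1 h2
      rw [h1, hw0 y h2, add_zero]
    have h9 : T G (u x) = ev T u x F := by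
      symm
      refine ev_eq hT (hu x) ?_
      filter_upwards [hGev x hx, hwx, hF.rep_eq] with y h1 h2 h3
      rw [h1, h2, ← h3, ← hf]
      ring
    simp only [zero_smul, add_zero, sub_zero] at h7
    rw [h8, h9, norm_sub_rev] at h7
    exact h7
  by_contra hne
  have hpos : 0 < ‖ev T u x F - 1‖ := norm_pos_iff.2 (sub_ne_zero.2 hne)
  set d := ‖ev T u x F - 1‖ with hd
  set m := 1 + 2 * D + (3 / ρ + 3 * (C + 1) / d) with hm
  have p1 : 0 < 3 / ρ := by positivity
  have p2 : 0 < 3 * (C + 1) / d := by positivity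
  have h1 := main m (by linarith) (by linarith) (by linarith)
  have hm0 : 0 < m := by linarith
  have h2 : 3 * (C + 1) < m * d := by
    have : 3 * (C + 1) / d < m := by linarith
    rwa [div_lt_iff₀ hpos] at this
  rw [← mul_div_assoc, le_div_iff₀ hm0] at h1
  linarith

end SchwartzMul

/-! ### Constants: identity or conjugation -/

namespace SchwartzMul

open Filter Topology

variable {E : Type} [NormedAddCommGroup E] [InnerProductSpace ℝ E]

theorem norm_second_difference_le {G : E → ℂ} (hG : ContDiff ℝ ∞ G) {x e : E} (he : ‖e‖ = 1)
    {ε C : ℝ} (hε : 0 < ε)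
    (hC : ∀ y ∈ Metric.ball x (3 * ε), ‖fderiv ℝ (fderiv ℝ G) y‖ ≤ C) :
    ‖G (x + (2 * ε) • e) - 2 * G (x + ε • e) + G x‖ ≤ C * ε ^ 2 := by
  have hG' : ContDiff ℝ ∞ (fderiv ℝ G) := hG.fderiv_right (by simp)
  have hd : Differentiable ℝ G := hG.differentiable (by simp)
  have hεn : ‖ε • e‖ = ε := by rw [norm_smul, he, mul_one, Real.norm_of_nonneg hε.le]
  have hs : Differentiable ℝ fun y => G (y + ε • e) :=
    hd.comp (differentiable_id.add_const (ε • e))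
  have h1 : ∀ y ∈ Metric.ball x (2 * ε),
      ‖fderiv ℝ (fun y => G (y + ε • e) - G y) y‖ ≤ C * ε := fun y hy => by
    have h2 : fderiv ℝ (fun y => G (y + ε • e) - G y) y =
        fderiv ℝ G (y + ε • e) - fderiv ℝ G y := by
      rw [fderiv_fun_sub (hs y) (hd y), fderiv_comp_add_right]
    rw [h2]
    rw [mem_ball_iff_norm] at hy
    have h3 := (convex_ball x (3 * ε)).norm_image_sub_le_of_norm_fderiv_le (𝕜 := ℝ)
      (fun z _ => hG'.differentiable (by simp) z) hC (x := y) (y := y + ε • e)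
      (by rw [mem_ball_iff_norm]; linarith)
      (by
        rw [mem_ball_iff_norm, add_sub_right_comm]
        have := norm_add_le (y - x) (ε • e)
        linarith)
    rwa [add_sub_cancel_left, hεn] at h3
  have h4 := (convex_ball x (2 * ε)).norm_image_sub_le_of_norm_fderiv_le (𝕜 := ℝ)
    (f := fun y => G (y + ε • e) - G y)
    (fun z _ => (hs z).sub (hd z)) h1 (x := x) (y := x + ε • e)
    (by rw [mem_ball_iff_norm, sub_self, norm_zero]; linarith)
    (by rw [mem_ball_iff_norm, add_sub_cancel_left]; linarith)
  rw [add_sub_cancel_left, hεn, add_assoc, ← add_smul, ← two_mul] at h4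
  calc _ = ‖G (x + (2 * ε) • e) - G (x + ε • e) - (G (x + ε • e) - G x)‖ := by
        congr 1; ring
    _ ≤ C * ε * ε := h4
    _ = C * ε ^ 2 := by ring

theorem norm_pow_sub_one_le {z : ℂ} (hz : ‖z‖ = 1) (i : ℕ) : ‖z ^ i - 1‖ ≤ i * ‖z - 1‖ := by
  induction i with
  | zero => simp
  | succ i ih =>
    have : z ^ (i + 1) - 1 = z ^ i * (z - 1) + (z ^ i - 1) := by ring
    rw [this]
    refine (norm_add_le _ _).trans ?_
    rw [norm_mul, norm_pow, hz, one_pow]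
    push_cast
    linarith

theorem tendsto_half_pow_smul (x e : E) (t : ℝ) :
    Tendsto (fun i : ℕ => x + (t * (1 / 2) ^ i) • e) atTop (𝓝 x) := by
  have h1 : Tendsto (fun i : ℕ => ((1 : ℝ) / 2) ^ i) atTop (𝓝 0) :=
    tendsto_pow_atTop_nhds_zero_of_lt_one (by norm_num) (by norm_num)
  simpa using ((h1.const_mul t).smul_const e).const_add x

/-- The quotient is unimodular and differs from one by `O(2⁻ⁱ)`, so its `i`-th power differs from
one by `O(i 2⁻ⁱ)`. -/
theorem tendsto_div_pow {R : E → ℂ} {x : E} (hR : DifferentiableAt ℝ R x)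
    (hn : ∀ y, ‖R y‖ = ‖R x‖) (h0 : R x ≠ 0) (e : E) (t : ℝ) :
    Tendsto (fun i : ℕ => (R (x + (t * (1 / 2) ^ i) • e) / R x) ^ i) atTop (𝓝 1) := by
  have hpos := norm_pos_iff.2 h0
  obtain ⟨K, hK⟩ := hR.hasFDerivAt.isBigO_sub.bound
  rw [tendsto_iff_norm_sub_tendsto_zero]
  have t2 : Tendsto (fun i : ℕ => (i : ℝ) ^ 1 / 2 ^ i) atTop (𝓝 0) :=
    tendsto_pow_const_div_const_pow_of_one_lt 1 (by norm_num)
  have t3 := t2.const_mul (K / ‖R x‖ * (|t| * ‖e‖))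
  rw [mul_zero] at t3
  refine squeeze_zero' (Eventually.of_forall fun _ => norm_nonneg _) ?_ t3
  filter_upwards [(tendsto_half_pow_smul x e t).eventually hK] with i hi
  have h1 : ‖R (x + (t * (1 / 2) ^ i) • e) / R x‖ = 1 := by
    rw [norm_div, hn, div_self hpos.ne']
  refine (norm_pow_sub_one_le h1 i).trans ?_
  rw [add_sub_cancel_left, norm_smul, norm_mul, norm_pow, Real.norm_eq_abs] at hi
  have h2 : R (x + (t * (1 / 2) ^ i) • e) / R x - 1 =
      (R (x + (t * (1 / 2) ^ i) • e) - R x) / R x := by field_simp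
  rw [h2, norm_div]
  calc _ ≤ i * (K * (|t| * ‖(1 / 2 : ℝ)‖ ^ i * ‖e‖) / ‖R x‖) := by gcongr
    _ = K / ‖R x‖ * (|t| * ‖e‖) * ((i : ℝ) ^ 1 / 2 ^ i) := by
      rw [Real.norm_of_nonneg (by norm_num), one_div, inv_pow]
      field_simp

variable [FiniteDimensional ℝ E] {T : 𝓢(E, ℂ) ≃ 𝓢(E, ℂ)} {u : E → E}

theorem differentiableAt_ev_const (hT : MulPres T) (hu : ∀ x, Corr T x (u x))
    (hus : ContDiff ℝ ∞ u) (x : E) (c : ℂ) :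
    DifferentiableAt ℝ (fun y => ev T u y fun _ => c) x := by
  have h1 : DifferentiableAt ℝ (fun z => T (rep x fun _ => c) (u z)) x :=
    (contDiff_comp_map hus _).differentiable (by simp) x
  refine h1.congr_of_eventuallyEq ?_
  filter_upwards [(isSm_const (x := x) c).rep_eq.eventually_nhds] with y hy
  exact ev_eq hT (hu y) hy

theorem norm_ev (hn : ∀ f x, ‖T f (u x)‖ = ‖f x‖) {x : E} {F : E → ℂ} (hF : IsSm F x) :
    ‖ev T u x F‖ = ‖F x‖ := by
  rw [ev, hn, hF.rep_eq.self_of_nhds]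

theorem map_eq_ev_const (hT : MulPres T) (hu : ∀ x, Corr T x (u x))
    (hn : ∀ f x, ‖T f (u x)‖ = ‖f x‖) {x : E}
    (h1 : ∀ F : E → ℂ, IsSm F x → F x = 1 → ev T u x F = 1) (f : 𝓢(E, ℂ)) :
    T f (u x) = ev T u x fun _ => f x := by
  by_cases h0 : f x = 0
  · rw [h0]
    have h2 : ‖ev T u x fun _ => 0‖ = 0 := by rw [norm_ev hn (isSm_const _), norm_zero]
    have h3 : ‖T f (u x)‖ = 0 := by rw [hn, h0, norm_zero]
    rw [norm_eq_zero.1 h2, norm_eq_zero.1 h3]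
  · have hsm : IsSm (fun y => f y * (f x)⁻¹) x := (isSm_schwartz f).mul (isSm_const _)
    have h2 := ev_mul hT (hu x) hsm (isSm_const (f x))
    rw [h1 _ hsm (mul_inv_cancel₀ h0), one_mul] at h2
    rw [← h2]
    refine (ev_eq hT (hu x) (Eventually.of_forall fun y => ?_)).symm
    field_simp

/-- An affine function takes the values `κ ε (a + t b)`, `t = 0, 1, 2`, at three points spaced by `ε
= 2⁻ⁱ`. The second difference of its image is `O(ε²)`, while the image of the factor `κ ε` has
modulus `κ ε`; dividing by it and letting `ε → 0` leaves the second difference of the values at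
constants. Taking `ε = (1/2)ⁱ` reduces the varying constant to powers of the image of `1/2`. -/
theorem ev_const_jensen (hT : MulPres T) (hu : ∀ x, Corr T x (u x))
    (hus : ContDiff ℝ ∞ u) (hn : ∀ f x, ‖T f (u x)‖ = ‖f x‖) {e : E} (he : ‖e‖ = 1) {x : E} {r : ℝ}
    (hr : 0 < r)
    (h1 : ∀ y ∈ Metric.ball x r, ∀ F : E → ℂ, IsSm F y → F y = 1 → ev T u y F = 1)
    {N : ℕ} {δ C : ℝ} (hδ : 0 < δ) (hC : ∀ y ∈ Metric.ball x r, ∀ g : 𝓢(E, ℂ), CB N δ g →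
      ‖fderiv ℝ (fderiv ℝ fun y => T g (u y)) y‖ ≤ C) (a b : ℂ) :
    (ev T u x fun _ => a + 2 * b) - 2 * (ev T u x fun _ => a + b) + (ev T u x fun _ => a) = 0 := by
  let m : E → ℂ → ℂ := fun y c => ev T u y fun _ => c
  have hm : ∀ y c d, m y (c * d) = m y c * m y d := fun y c d =>
    ev_mul hT (hu y) (isSm_const c) (isSm_const d)
  have hmp : ∀ y c i, m y (c ^ i) = m y c ^ i := fun y c i =>
    ev_pow hT (hu y) (isSm_const c) i
  have hmn : ∀ y c, ‖m y c‖ = ‖c‖ := fun y c => norm_ev hn (isSm_const c)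
  have hmd : ∀ c, DifferentiableAt ℝ (fun y => m y c) x := differentiableAt_ev_const hT hu hus x
  let l : E →L[ℝ] ℂ := (innerSL ℝ e).smulRight b
  obtain ⟨A, hA1, hA⟩ := exists_affine_bound x hr N (norm_nonneg l)
  -- This scaling makes the affine functions at all small scales `C^N`-small by the same factor.
  set κ : ℝ := δ / A with hκ
  have hκ0 : 0 < κ := by positivity
  have hκn : ‖(κ : ℂ)‖ = κ := by rw [Complex.norm_real, Real.norm_of_nonneg hκ0.le]
  have hκ0' : (κ : ℂ) ≠ 0 := by exact_mod_cast hκ0.ne'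
  let Y : ℝ → ℕ → E := fun t i => x + (t * (1 / 2) ^ i) • e
  -- `V t i` is the value of the image at `u (Y t i)` divided by `m x κ * m x (1 / 2) ^ i`; the
  -- first two factors, which account for the moving base point, tend to one.
  let V : ℝ → ℕ → ℂ := fun t i => m (Y t i) κ / m x κ * (m (Y t i) (1 / 2) / m x (1 / 2)) ^ i *
    m (Y t i) (a + t * b)
  have hY : ∀ t, Tendsto (Y t) atTop (𝓝 x) := tendsto_half_pow_smul x e
  have hne : ∀ y c, c ≠ 0 → m y c ≠ 0 := fun y c hc => by
    rw [← norm_pos_iff, hmn]; exact norm_pos_iff.2 hc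
  have hV : ∀ t, Tendsto (V t) atTop (𝓝 (m x (a + t * b))) := fun t => by
    have t1 : Tendsto (fun i => m (Y t i) κ / m x κ) atTop (𝓝 1) := by
      have := ((hmd κ).continuousAt.tendsto.comp (hY t)).div_const (m x κ)
      rwa [div_self (hne _ _ hκ0')] at this
    have t2 : Tendsto (fun i => (m (Y t i) (1 / 2) / m x (1 / 2)) ^ i) atTop (𝓝 1) :=
      tendsto_div_pow (hmd (1 / 2)) (fun y => by rw [hmn, hmn]) (hne _ _ (by norm_num)) e t
    have t3 : Tendsto (fun i => m (Y t i) (a + t * b)) atTop (𝓝 (m x (a + t * b))) :=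
      (hmd _).continuousAt.tendsto.comp (hY t)
    have := (t1.mul t2).mul t3
    rw [one_mul, one_mul] at this
    exact this
  have hhalf : Tendsto (fun i : ℕ => ((1 : ℝ) / 2) ^ i) atTop (𝓝 0) :=
    tendsto_pow_atTop_nhds_zero_of_lt_one (by norm_num) (by norm_num)
  have hbound : ∀ᶠ i in atTop, ‖V 2 i - 2 * V 1 i + V 0 i‖ ≤ C / κ * (1 / 2) ^ i := by
    have e1 := (hhalf.const_mul ‖a‖).eventually_le_const (u := 2) (by norm_num)
    have e2 := (hhalf.const_mul 3).eventually_lt_const (u := r) (by simpa using hr)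
    filter_upwards [e1, e2] with i h2 h3
    set ε : ℝ := (1 / 2) ^ i with hε
    have hε0 : 0 < ε := by positivity
    have hεn : ‖(1 / 2 : ℂ) ^ i‖ = ε := by rw [hε, norm_pow]; norm_num
    obtain ⟨g, hg, hgx⟩ := hA x (Metric.mem_ball_self hr) (a * (1 / 2) ^ i) l
      (by rwa [norm_mul, hεn]) le_rfl
    have hgδ : CB N δ ((κ : ℂ) • g : 𝓢(E, ℂ)) := (hg.const_mul (contDiff_coe g) κ).mono (by
      rw [hκn, hκ, div_mul_cancel₀ _ (by linarith)])
    have hYb : ∀ t : ℝ, 0 ≤ t → t ≤ 2 → Y t i ∈ Metric.ball x r := fun t ht0 ht2 => by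
      rw [mem_ball_iff_norm, add_sub_cancel_left, norm_smul, he, mul_one,
        Real.norm_of_nonneg (by positivity)]
      change t * ε < r
      nlinarith
    have hval : ∀ t : ℝ, 0 ≤ t → t ≤ 2 →
        T ((κ : ℂ) • g) (u (Y t i)) = m x κ * m x (1 / 2) ^ i * V t i := fun t ht0 ht2 => by
      have hy := hYb t ht0 ht2
      have h5 : ((κ : ℂ) • g : 𝓢(E, ℂ)) (Y t i) = κ * ((1 / 2) ^ i * (a + t * b)) := by
        change (κ : ℂ) * g (Y t i) = _
        rw [hgx _ hy, add_sub_cancel_left]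
        simp only [l, ContinuousLinearMap.smulRight_apply, innerSL_apply_apply, inner_smul_right,
          real_inner_self_eq_norm_sq, he, Complex.real_smul]
        push_cast
        ring
      rw [map_eq_ev_const hT hu hn (h1 _ hy), h5]
      change m (Y t i) _ = _
      rw [hm, hm, hmp]
      simp only [V]
      have := hne x κ hκ0'
      have := hne x (1 / 2) (by norm_num)
      rw [div_pow]
      field_simp
    have h6 := norm_second_difference_le (contDiff_comp_map hus ((κ : ℂ) • g)) he (x := x) hε0
      (C := C) (fun y hy => hC y (Metric.ball_subset_ball h3.le hy) _ hgδ)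
    have hY2 : x + (2 * ε) • e = Y 2 i := rfl
    have hY1 : x + ε • e = Y 1 i := by simp only [Y, one_mul, hε]
    have hY0 : x = Y 0 i := by simp [Y]
    have hval0 := hval 0 le_rfl (by norm_num)
    rw [← hY0] at hval0
    rw [hY2, hY1, hval 2 (by norm_num) le_rfl, hval 1 (by norm_num) (by norm_num), hval0] at h6
    have h7 : m x κ * m x (1 / 2) ^ i * V 2 i - 2 * (m x κ * m x (1 / 2) ^ i * V 1 i) +
        m x κ * m x (1 / 2) ^ i * V 0 i =
        (m x κ * m x (1 / 2) ^ i) * (V 2 i - 2 * V 1 i + V 0 i) := by ring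
    rw [h7, norm_mul, norm_mul, ← hmp, hmn, hmn, hκn, hεn] at h6
    rw [div_mul_eq_mul_div, le_div_iff₀ hκ0]
    have h8 : ε * (‖V 2 i - 2 * V 1 i + V 0 i‖ * κ) ≤ ε * (C * ε) := by nlinarith
    exact le_of_mul_le_mul_left h8 hε0
  have hlim := (((hV 2).sub ((hV 1).const_mul 2)).add (hV 0)).norm
  have hlim0 := hhalf.const_mul (C / κ)
  rw [mul_zero] at hlim0
  have h9 := le_of_tendsto_of_tendsto hlim hlim0 hbound
  have h10 := norm_le_zero_iff.1 h9
  push_cast at h10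
  simpa [m] using h10

theorem ev_const_eq_id_or_conj (hT : MulPres T) (hu : ∀ x, Corr T x (u x))
    (hn : ∀ f x, ‖T f (u x)‖ = ‖f x‖) {x : E}
    (hJ : ∀ a b : ℂ, (ev T u x fun _ => a + 2 * b) - 2 * (ev T u x fun _ => a + b) +
      (ev T u x fun _ => a) = 0) :
    (∀ c : ℂ, ev T u x (fun _ => c) = c) ∨ ∀ c : ℂ, ev T u x (fun _ => c) = conj c := by
  let m : ℂ → ℂ := fun c => ev T u x fun _ => c
  have hmn : ∀ c, ‖m c‖ = ‖c‖ := fun c => norm_ev hn (isSm_const c)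
  have h0 : m 0 = 0 := by rw [← norm_eq_zero, hmn, norm_zero]
  have hJ' : ∀ a b, m (a + 2 * b) - 2 * m (a + b) + m a = 0 := hJ
  have h2 : ∀ c, m (2 * c) = 2 * m c := fun c => by
    have := hJ' 0 c
    rw [zero_add, zero_add, h0] at this
    linear_combination this
  have hadd : ∀ c d, m (c + d) = m c + m d := fun c d => by
    have := hJ' (2 * c) (d - c)
    rw [show 2 * c + 2 * (d - c) = 2 * d by ring, show 2 * c + (d - c) = c + d by ring,
      h2, h2] at this
    linear_combination -this / 2
  let φ : ℂ →+* ℂ :=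
    { toFun := m
      map_one' := ev_one hT (hu x)
      map_mul' := fun c d => ev_mul hT (hu x) (isSm_const c) (isSm_const d)
      map_zero' := h0
      map_add' := hadd }
  have hc : Continuous φ := (AddMonoidHomClass.isometry_of_norm φ hmn).continuous
  rcases Complex.ringHom_eq_id_or_conj_of_continuous hc with h | h
  · exact Or.inl fun c => congrArg (fun ψ : ℂ →+* ℂ => ψ c) h
  · exact Or.inr fun c => congrArg (fun ψ : ℂ →+* ℂ => ψ c) h

theorem frequently_eq_id_or_conj [Nontrivial E] (hT : MulPres T) (hu : ∀ x, Corr T x (u x))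
    (hus : ContDiff ℝ ∞ u) (hn : ∀ f x, ‖T f (u x)‖ = ‖f x‖) (x₀ : E) :
    ∃ᶠ x in 𝓝 x₀, (∀ f : 𝓢(E, ℂ), T f (u x) = f x) ∨ ∀ f : 𝓢(E, ℂ), T f (u x) = conj (f x) := by
  rw [(nhds_basis_opens x₀).frequently_iff]
  rintro W ⟨hx, hW⟩
  obtain ⟨e, he⟩ := exists_norm_eq E zero_le_one
  have hd1 : ∀ g : 𝓢(E, ℂ), ContDiff ℝ ∞ (fderiv ℝ fun y => T g (u y)) := fun g =>
    (contDiff_comp_map hus g).fderiv_right (by simp)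
  have hd2 : ∀ g : 𝓢(E, ℂ), ContDiff ℝ ∞ (fderiv ℝ (fderiv ℝ fun y => T g (u y))) := fun g =>
    (hd1 g).fderiv_right (by simp)
  obtain ⟨z, r, hr, hsub, N, δ, C, hδ, hB⟩ := exists_ball_bound
    -- The sum controls both derivatives on one common ball: the first feeds `exists_ldBound`, the
    -- second `ev_const_jensen`.
    (fun x g => ‖fderiv ℝ (fun y => T g (u y)) x‖ + ‖fderiv ℝ (fderiv ℝ fun y => T g (u y)) x‖)
    (fun x f g h => by
      have h1 := eventually_map_eq hT hu h
      rw [h1.fderiv_eq, h1.fderiv.fderiv_eq])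
    (fun g x r => by
      have hc : Continuous fun x => ‖fderiv ℝ (fun y => T g (u y)) x‖ +
          ‖fderiv ℝ (fderiv ℝ fun y => T g (u y)) x‖ := by
        have hnc : ∀ {F : Type} [NormedAddCommGroup F] [NormedSpace ℝ F] {H : E → F},
          ContDiff ℝ ∞ H → Continuous fun x => ‖H x‖ := fun h => h.continuous.norm
        exact (hnc (hd1 g)).add (hnc (hd2 g))
      obtain ⟨C, hC⟩ := (isCompact_closedBall x r).bddAbove_image hc.continuousOn
      exact ⟨C, fun y hy => hC ⟨y, hy, rfl⟩⟩) hW ⟨x₀, hx⟩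
  obtain ⟨K, hK0, hK⟩ := exists_ldBound hT hu hus hn he hr hδ
    fun x hx g hg => (le_add_of_nonneg_right
      (norm_nonneg (fderiv ℝ (fderiv ℝ fun y => T g (u y)) x))).trans (hB x hx g hg)
  have h1 : ∀ y ∈ Metric.ball z r, ∀ F : E → ℂ, IsSm F y → F y = 1 → ev T u y F = 1 :=
    fun y hy F hF hF1 => ev_eq_one_of_ldBound hT hu hus hn he hr hK0 hK hy hF hF1
  have hz := Metric.mem_ball_self (x := z) hr
  refine ⟨z, hsub hz, ?_⟩
  have hJ := ev_const_jensen hT hu hus hn he hr h1 hδ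
    fun x hx g hg => (le_add_of_nonneg_left
      (norm_nonneg (fderiv ℝ (fun y => T g (u y)) x))).trans (hB x hx g hg)
  rcases ev_const_eq_id_or_conj hT hu hn hJ with h | h
  · exact Or.inl fun f => (map_eq_ev_const hT hu hn (h1 z hz) f).trans (h _)
  · exact Or.inr fun f => (map_eq_ev_const hT hu hn (h1 z hz) f).trans (h _)

/-- A multiplicative bijection of the Schwartz space is, up to a diffeomorphism, the identity or
the complex conjugation. -/
theorem MulPres.exists_diffeo [Nontrivial E] (hT : MulPres T) :
    ∃ u : E ≃ₜ E, ContDiff ℝ ∞ u ∧ ContDiff ℝ ∞ u.symm ∧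
      ((∀ f x, T f (u x) = f x) ∨ ∀ f x, T f (u x) = conj (f x)) := by
  obtain ⟨u, hu, hus, hvs, hn⟩ := hT.exists_norm_eq
  refine ⟨u, hus, hvs, ?_⟩
  have hfr := frequently_eq_id_or_conj hT hu hus hn
  -- The image of `I` detects which alternative holds. It is continuous with values `I` and `-I`
  -- only, hence constant on the connected space.
  let σ : E → ℂ := fun x => ev T u x fun _ => Complex.I
  have hσc : Continuous σ := continuous_iff_continuousAt.2 fun x =>
    (differentiableAt_ev_const hT hu hus x Complex.I).continuousAt
  have hrep : ∀ x : E, rep x (fun _ => Complex.I) x = Complex.I := fun x =>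
    (isSm_const Complex.I).rep_eq.self_of_nhds
  have hσ1 : ∀ x, (∀ f : 𝓢(E, ℂ), T f (u x) = f x) → σ x = Complex.I := fun x h =>
    (h _).trans (hrep x)
  have hσ2 : ∀ x, (∀ f : 𝓢(E, ℂ), T f (u x) = conj (f x)) → σ x = -Complex.I := fun x h =>
    (h _).trans (by rw [hrep, Complex.conj_I])
  have hII : Complex.I ≠ -Complex.I := fun h => by
    have := congrArg Complex.im h
    simp at this
    linarith
  have hσ : ∀ x, σ x = Complex.I ∨ σ x = -Complex.I := fun x => by
    have h1 := eq_of_frequently_eq (f := fun x => (σ x - Complex.I) * (σ x + Complex.I))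
      (g := fun _ => 0) (x := x) (by fun_prop) continuousAt_const ((hfr x).mono fun y hy => by
        rcases hy with h | h
        · simp [hσ1 y h]
        · simp [hσ2 y h])
    rcases mul_eq_zero.1 h1 with h | h
    · exact Or.inl (sub_eq_zero.1 h)
    · exact Or.inr (eq_neg_of_add_eq_zero_left h)
  have hclopen : IsClopen {x | σ x = Complex.I} := by
    refine ⟨isClosed_eq hσc continuous_const, ?_⟩
    have : {x | σ x = Complex.I} = {x | σ x = -Complex.I}ᶜ := by
      ext x
      simp only [Set.mem_ofPred_eq, Set.mem_compl_iff]
      constructor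
      · intro h h'
        exact hII (h ▸ h')
      · exact fun h => (hσ x).resolve_right h
    rw [this]
    exact (isClosed_eq hσc continuous_const).isOpen_compl
  have hTc : ∀ f : 𝓢(E, ℂ), Continuous fun x => T f (u x) := fun f =>
    (T f).continuous.comp u.continuous
  rcases isClopen_iff.1 hclopen with h | h
  · right
    intro f x
    refine eq_of_frequently_eq (hTc f).continuousAt
      (Complex.continuous_conj.comp f.continuous).continuousAt ((hfr x).mono fun y hy => ?_)
    rcases hy with h' | h'
    · have : y ∈ {x | σ x = Complex.I} := hσ1 y h'
      rw [h] at this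
      exact this.elim
    · exact h' f
  · left
    intro f x
    refine eq_of_frequently_eq (hTc f).continuousAt f.continuous.continuousAt
      ((hfr x).mono fun y hy => ?_)
    rcases hy with h' | h'
    · exact h' f
    · have : y ∈ {x | σ x = Complex.I} := h ▸ Set.mem_univ y
      exact (hII (this.symm.trans (hσ2 y h'))).elim

end SchwartzMul

/-! ### Transfer through the Fourier transform -/

namespace SchwartzMul

open Filter Topology

variable {n : ℕ}

theorem coe_fourier_conjS (f : SchwartzFourier.Schw n) (x : EuclideanSpace ℝ (Fin n)) :
    (𝓕 (SchwartzFourier.conjS f) : SchwartzFourier.Schw n) x =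
      conj ((𝓕 f : SchwartzFourier.Schw n) (-x)) := by
  rw [SchwartzFourier.fourier_apply, SchwartzFourier.fourier_apply, ← integral_conj]
  refine integral_congr_ae (Filter.Eventually.of_forall fun y => ?_)
  change conj (f y) * _ = conj (f y * _)
  rw [map_mul, ← Complex.exp_conj, inner_neg_right]
  congr 2
  simp only [map_mul, map_neg, Complex.conj_ofReal, Complex.conj_I, map_ofNat]
  push_cast
  ring

theorem fourier_conv (f g : SchwartzFourier.Schw n) :
    (𝓕 (SchwartzFourier.conv f g) : SchwartzFourier.Schw n) = sm (𝓕 f) (𝓕 g) := by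
  have h : SchwartzFourier.conv f g =
      SchwartzMap.convolution (ContinuousLinearMap.mul ℂ ℂ) f g :=
    DFunLike.coe_injective (SchwartzFourier.integral_eq_convolution f g)
  rw [h, SchwartzMap.fourier_convolution]
  rfl

/-- A homeomorphism that is smooth together with its inverse, as a diffeomorphism. -/
def diffeo (u : EuclideanSpace ℝ (Fin n) ≃ₜ EuclideanSpace ℝ (Fin n)) (hu : ContDiff ℝ ∞ u)
    (hv : ContDiff ℝ ∞ u.symm) : SchwartzFourier.Diffeo n where
  toEquiv := u.toEquiv
  contMDiff_toFun := contMDiff_iff_contDiff.2 hu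
  contMDiff_invFun := contMDiff_iff_contDiff.2 hv

end SchwartzMul

theorem mainTheorem3 (n : ℕ) (hn : 1 ≤ n)
    (T : SchwartzFourier.Schw n → SchwartzFourier.Schw n) (hT : Function.Bijective T) :
    ((∀ f g, T (SchwartzFourier.conv f g) = SchwartzFourier.prod (T f) (T g)) →
      ∃ u : SchwartzFourier.Diffeo n,
        (∀ f, ∀ x, T f (u x) = (𝓕 f : SchwartzFourier.Schw n) x) ∨
        (∀ f, ∀ x, T f (u x) =
          (𝓕 (SchwartzFourier.conjS f) : SchwartzFourier.Schw n) x)) ∧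
    ((∀ f g, T (SchwartzFourier.prod f g) = SchwartzFourier.conv (T f) (T g)) →
      ∃ u : SchwartzFourier.Diffeo n,
        (∀ f, ∃ g : SchwartzFourier.Schw n, (∀ x, g x = f (u x)) ∧ T f = 𝓕 g) ∨
        (∀ f, ∃ g : SchwartzFourier.Schw n, (∀ x, g x = f (u x)) ∧
          T f = 𝓕 (SchwartzFourier.conjS g))) := by
  have : Nonempty (Fin n) := ⟨⟨0, hn⟩⟩
  have : Nontrivial (EuclideanSpace ℝ (Fin n)) := inferInstance
  let Φ : SchwartzFourier.Schw n ≃ SchwartzFourier.Schw n :=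
    (FourierTransform.fourierEquiv ℂ (SchwartzFourier.Schw n)).toEquiv
  have hΦ : ∀ f g, Φ (SchwartzFourier.conv f g) = SchwartzMul.sm (Φ f) (Φ g) :=
    SchwartzMul.fourier_conv
  let S := Equiv.ofBijective T hT
  constructor
  · intro h
    have hS : SchwartzMul.MulPres (Φ.symm.trans S) := fun f g => by
      have h1 := h (Φ.symm f) (Φ.symm g)
      have h2 : Φ.symm (SchwartzMul.sm f g) =
          SchwartzFourier.conv (Φ.symm f) (Φ.symm g) := by
        rw [Equiv.symm_apply_eq, hΦ, Equiv.apply_symm_apply, Equiv.apply_symm_apply]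
      rw [← h2] at h1
      exact h1
    have hST : ∀ f, (Φ.symm.trans S) (Φ f) = T f := fun f =>
      congrArg T (Equiv.symm_apply_apply Φ f)
    obtain ⟨v, hv, hv', h1 | h1⟩ := hS.exists_diffeo
    · refine ⟨SchwartzMul.diffeo v hv hv', Or.inl fun f x => ?_⟩
      rw [← hST]
      exact h1 _ x
    -- The reflection compensates for the sign when conjugation passes through the Fourier
    -- transform.
    · refine ⟨SchwartzMul.diffeo ((Homeomorph.neg _).trans v) (hv.comp contDiff_neg)
        (contDiff_neg.comp hv'), Or.inr fun f x => ?_⟩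
      rw [← hST, SchwartzMul.coe_fourier_conjS]
      exact h1 _ (-x)
  · intro h
    have hS : SchwartzMul.MulPres (S.trans Φ.symm) := fun f g => by
      change Φ.symm (T (SchwartzFourier.prod f g)) =
        SchwartzMul.sm (Φ.symm (T f)) (Φ.symm (T g))
      rw [h]
      ext x
      -- The inverse transform is the forward one reflected, so it too turns convolution into
      -- product.
      have hinv : ∀ k : SchwartzFourier.Schw n, Φ.symm k x = Φ k (-x) := fun k =>
        congrFun (SchwartzMap.fourierInv_coe k) x |>.trans (by
          rw [Real.fourierInv_eq_fourier_neg]; rfl)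
      rw [hinv, hΦ, SchwartzMul.sm_apply, SchwartzMul.sm_apply, hinv, hinv]
    have hST : ∀ f, T f = 𝓕 ((S.trans Φ.symm) f) := fun f =>
      (Equiv.apply_symm_apply Φ (T f)).symm
    obtain ⟨v, hv, hv', h1 | h1⟩ := hS.exists_diffeo
    -- The composite `f ∘ v.symm` is the inverse Fourier transform of `T f`, so it is a Schwartz
    -- function without any growth estimate on `v.symm`.
    · refine ⟨SchwartzMul.diffeo v.symm hv' hv, Or.inl fun f =>
        ⟨(S.trans Φ.symm) f, fun x => ?_, hST f⟩⟩
      have := h1 f (v.symm x)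
      rwa [Homeomorph.apply_symm_apply] at this
    · refine ⟨SchwartzMul.diffeo v.symm hv' hv, Or.inr fun f =>
        ⟨SchwartzFourier.conjS ((S.trans Φ.symm) f), fun x => ?_, ?_⟩⟩
      · have := h1 f (v.symm x)
        rw [Homeomorph.apply_symm_apply] at this
        change conj ((S.trans Φ.symm) f x) = _
        rw [this, Complex.conj_conj]
        rfl
      · rw [hST f]
        congr 1
        ext x
        exact (Complex.conj_conj _).symm
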